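/- Let $d\in\mathbb N$, $1\le p<d/2$ (so $d\ge 3$) and $q>dp/(d-p)$ (so $q>p$). For Borel probability measures $\mu,\nu$ on $\mathbb R^d$ equipped with a norm $\|\cdot\|$, let \[ W_p(\mu,\nu)=\inf_{\gamma}\Big(\int\|x-y\|^p\,d\gamma(x,y)\Big)^{1/p}, \] the infimum being over all couplings $\gamma$ of $\mu$ and $\nu$. Let \[ c_{p,q}:=2^{1/q}\,\frac{2^{1/p-1/q}}{2^{1/p-1/q}-1}+\frac{2^{1/p}}{2^{1/p}-1}. \] Then there is a constant $\kappa_{p,q,d}>0$, depending only on $p,q,d$, such that for every norm $\|\cdot\|$ on $\mathbb R^d$, every Borel probability measure $\mu$ on $\mathbb R^d$, every $n\ge1$, and all i.i.d. samples $X_1,\dots,X_n$ from $\mu$ with empirical measure $\mu_n:=\frac1n\sum_{i=1}^n\delta_{X_i}$, the following two assertions hold. (i) (Expectation bound.) \[ \big(\mathbb E\,W_p^p(\mu_n,\mu)\big)^{1/p}\le\kappa_{p,q,d}\Big(\int_{\mathbb R^d}\|x\|^q\,d\mu(x)\Big)^{1/q}n^{-1/d}. \] (ii) (Concentration with the same constant.)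 If $e\in\mathbb R^d$ and $M_q>0$ satisfy $\big(\int\|x-e\|^q\,d\mu(x)\big)^{1/q}\le M_q$, then for all $\eta\in(0,1)$ and $t>0$, \[ \mathbb P\Big[W_p^p(\mu_n,\mu)\ge\big(\kappa_{p,q,d}M_q(1+\eta)^{1/q}n^{-1/d}+c_{p,q}M_q\eta^{1/p-1/q}\big)^p+t\Big] \le 1-(1-\eta)^n+\exp\left(-\frac{2n\big(t-(1-(1-\eta)^n)(M_q\eta^{-1/q})^p\big)_+^2}{(M_q\eta^{-1/q})^{2p}}\right), \] where $s_+:=\max(s,0)$. -/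

import Mathlib

open MeasureTheory ProbabilityTheory
open scoped ENNReal

namespace EmpiricalWasserstein

/-- `γ` is a coupling (transport plan) of `μ` and `ν`: its marginals are `μ` and `ν`. -/
def IsCoupling {X : Type*} [MeasurableSpace X] (γ : Measure (X × X)) (μ ν : Measure X) : Prop :=
  γ.map Prod.fst = μ ∧ γ.map Prod.snd = ν

/-- The `p`-Wasserstein distance
`W_p(μ, ν) = inf_γ (∫ d(x, y) ^ p dγ(x, y)) ^ (1 / p)`, the infimum being over all couplings,
as an extended nonnegative real. -/
noncomputable def wasserstein {X : Type*} [PseudoEMetricSpace X] [MeasurableSpace X]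
    (p : ℝ) (μ ν : Measure X) : ℝ≥0∞ :=
  ⨅ (γ : Measure (X × X)) (_ : IsCoupling γ μ ν),
    (∫⁻ z, edist z.1 z.2 ^ p ∂γ) ^ (1 / p)

/-- The empirical measure `(1 / n) ∑ i, δ_{x i}` of the points `x 0, …, x (n - 1)`. -/
noncomputable def empiricalMeasure {X : Type*} [MeasurableSpace X] {n : ℕ} (x : Fin n → X) :
    Measure X :=
  (n : ℝ≥0∞)⁻¹ • ∑ i, Measure.dirac (x i)

/-- The `q`-th moment `(∫ d(e, x) ^ q dμ(x)) ^ (1 / q)` of `μ` about the point `e`,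
as an extended nonnegative real. -/
noncomputable def momentNorm {X : Type*} [PseudoEMetricSpace X] [MeasurableSpace X]
    (q : ℝ) (e : X) (μ : Measure X) : ℝ≥0∞ :=
  (∫⁻ x, edist e x ^ q ∂μ) ^ (1 / q)

/-- `X 0, …, X (n - 1)` are i.i.d. random variables on `(Ω, P)` with law `μ`. -/
structure IsIIDSample {Ω X : Type*} [MeasurableSpace Ω] [MeasurableSpace X]
    (P : Measure Ω) (μ : Measure X) {n : ℕ} (x : Fin n → Ω → X) : Prop where
  measurable : ∀ i, Measurable (x i)
  law : ∀ i, P.map (x i) = μ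
  indep : iIndepFun x P

/-- The constant
`c_{p,q} = 2^{1/q} 2^{1/p-1/q} / (2^{1/p-1/q} - 1) + 2^{1/p} / (2^{1/p} - 1)`. -/
noncomputable def truncConst (p q : ℝ) : ℝ :=
  (2 : ℝ) ^ (1 / q) * ((2 : ℝ) ^ (1 / p - 1 / q) / ((2 : ℝ) ^ (1 / p - 1 / q) - 1))
    + (2 : ℝ) ^ (1 / p) / ((2 : ℝ) ^ (1 / p) - 1)

end EmpiricalWasserstein

/-! The transport cost is dominated by a multiscale sum. Cut the space into dyadic shells about `e`,
in units of `M`, and the `k`-th shell into cubes of side `M 2^k / 2^j`. Matching mass inside the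
finest cells and passing only the leftovers on to coarser cells produces a coupling. Hence `W_p^p`
is at most `(2 d M)^p` times a discretisation error plus the sum of `(2^k / 2^j)^p |μ_n(Q) - μ(Q)|`
over cells `Q` of generations `j ≤ J` (`exists_coupling_le`, `wasserstein_rpow_le_cellSum`).
Auerbach coordinates make all constants independent of the norm.

Expectation: `E|μ_n(Q) - μ(Q)|` is at most `2 μ(Q)` and at most `(μ(Q) / n)^(1/2)`, hence at most `2
μ(Q)^(1-s/2) n^(-s/2)` for every `s` in `[0, 1]`. Hölder over the cubes of a shell and Markov on the
shells leave geometric series: the one in `k` converges when `p < q (1 - s/2)`, and the one in `j`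
is dominated by its last term when `p < d s / 2`. The hypotheses on `p` and `q` provide such an `s`,
and `2^J ≈ n^(1/d)` gives the order `n^(-p/d)`.

Concentration: `κ` is taken so large that Markov's inequality alone bounds the probability by a
small `ε` depending on `p, q, d`. This settles the case where the claimed bound is at least `ε`.
Otherwise `n η ≤ 2 ε`, and `T = η^(-1/q)` is large. Let `θ` be `t - (1 - (1-η)^n) (M T)^p` in units
of `(M T)^p`. Up to an event of probability at most `1 - (1-η)^n` the sample lies in the ball of
radius `M T`. There a large deviation forces one of two events. Either the shells of radius up to
about `M T / (64 d)` deviate, which McDiarmid's inequality controls because one point has little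
influence on them, or many points fall into the remaining shells, which a Chernoff bound controls.
Both have probability of order `exp(-4 n θ^2)`, and the surplus in the exponent absorbs the
numerical factor 3. The factor `(1+η)^(1/q)` and the term with `c_{p,q}` merely raise the threshold,
so only `≥ 1` and `≥ 0` are used about them. -/

namespace EmpiricalWasserstein

/-! ### Couplings from hierarchical matching -/

section Coupling

variable {X ι : Type*} [MeasurableSpace X]

/-- The measure on `X × X` matching, inside each fibre `Q` of `f`, the mass `min (α Q) (β Q)`. -/
noncomputable def fiberMatching (f : X → ι) (α β : Measure X) : Measure (X × X) :=
  Measure.sum fun i => (max (α (f ⁻¹' {i})) (β (f ⁻¹' {i})))⁻¹ •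
    (α.restrict (f ⁻¹' {i})).prod (β.restrict (f ⁻¹' {i}))

/-- The part of `α` that is left over after matching it with `β` inside each fibre of `f`. -/
noncomputable def fiberResidual (f : X → ι) (α β : Measure X) : Measure X :=
  Measure.sum fun i => (1 - β (f ⁻¹' {i}) / max (α (f ⁻¹' {i})) (β (f ⁻¹' {i}))) •
    α.restrict (f ⁻¹' {i})

theorem sum_restrict_fiber [Countable ι] [MeasurableSpace ι] [MeasurableSingletonClass ι]
    {f : X → ι} (hf : Measurable f) (α : Measure X) :
    Measure.sum (fun i => α.restrict (f ⁻¹' {i})) = α := by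
  rw [← Measure.restrict_iUnion]
  · have : ⋃ i, f ⁻¹' {i} = Set.univ := by ext x; simp
    rw [this, Measure.restrict_univ]
  · intro i j hij
    exact Disjoint.preimage f (by simpa using hij)
  · exact fun i => hf (measurableSet_singleton i)

theorem fiber_add_residual [Countable ι] [MeasurableSpace ι] [MeasurableSingletonClass ι]
    {f : X → ι} (hf : Measurable f) (α β : Measure X) [IsFiniteMeasure α] [IsFiniteMeasure β] :
    Measure.sum (fun i => (β (f ⁻¹' {i}) / max (α (f ⁻¹' {i})) (β (f ⁻¹' {i}))) •
      α.restrict (f ⁻¹' {i})) + fiberResidual f α β = α := by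
  unfold fiberResidual
  rw [Measure.sum_add_sum]
  conv_rhs => rw [← sum_restrict_fiber hf α]
  congr 1
  ext1 i
  rw [← add_smul, add_tsub_cancel_of_le, one_smul]
  exact ENNReal.div_le_of_le_mul (by rw [one_mul]; exact le_max_right _ _)

theorem fiberMatching_map_fst [Countable ι] (f : X → ι) (α β : Measure X)
    [IsFiniteMeasure α] [IsFiniteMeasure β] :
    (fiberMatching f α β).map Prod.fst =
      Measure.sum (fun i => (β (f ⁻¹' {i}) / max (α (f ⁻¹' {i})) (β (f ⁻¹' {i}))) •
      α.restrict (f ⁻¹' {i})) := by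
  unfold fiberMatching
  rw [Measure.map_sum measurable_fst.aemeasurable]
  congr 1
  ext1 i
  rw [Measure.map_smul, Measure.map_fst_prod, smul_smul, Measure.restrict_apply_univ, mul_comm,
    div_eq_mul_inv]

theorem fiberMatching_map_snd [Countable ι] (f : X → ι) (α β : Measure X)
    [IsFiniteMeasure α] [IsFiniteMeasure β] :
    (fiberMatching f α β).map Prod.snd =
      Measure.sum (fun i => (α (f ⁻¹' {i}) / max (β (f ⁻¹' {i})) (α (f ⁻¹' {i}))) •
      β.restrict (f ⁻¹' {i})) := by
  unfold fiberMatching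
  rw [Measure.map_sum measurable_snd.aemeasurable]
  congr 1
  ext1 i
  rw [Measure.map_smul, Measure.map_snd_prod, smul_smul, Measure.restrict_apply_univ, mul_comm,
    div_eq_mul_inv, max_comm]

theorem fiberMatching_ae [Countable ι] [MeasurableSpace ι] [MeasurableSingletonClass ι]
    {f : X → ι} (hf : Measurable f) (α β : Measure X)
    [IsFiniteMeasure α] [IsFiniteMeasure β] :
    ∀ᵐ z ∂(fiberMatching f α β), f z.1 = f z.2 := by
  unfold fiberMatching
  rw [Measure.ae_sum_iff]
  intro i
  apply Measure.ae_smul_measure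
  have hQ := hf (measurableSet_singleton i)
  rw [Measure.prod_restrict]
  filter_upwards [ae_restrict_mem (hQ.prod hQ)] with z hz
  have h1 : f z.1 = i := hz.1
  have h2 : f z.2 = i := hz.2
  rw [h1, h2]

/-- The matching removes mass `min (α Q) (β Q)` from both sides of a fibre, so truncated subtraction
gives what remains. -/
theorem fiberResidual_fiber [Countable ι] [MeasurableSpace ι] [MeasurableSingletonClass ι]
    {f : X → ι} (hf : Measurable f) (α β : Measure X)
    [IsFiniteMeasure α] [IsFiniteMeasure β] (i : ι) :
    fiberResidual f α β (f ⁻¹' {i}) = α (f ⁻¹' {i}) - β (f ⁻¹' {i}) := by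
  have hQ : ∀ i, MeasurableSet (f ⁻¹' {i}) := fun i => hf (measurableSet_singleton i)
  unfold fiberResidual
  rw [Measure.sum_apply _ (hQ i), tsum_eq_single i]
  · rw [Measure.smul_apply, Measure.restrict_apply_self, smul_eq_mul]
    set a := α (f ⁻¹' {i}) with ha
    set b := β (f ⁻¹' {i})
    have ha' : a ≠ ∞ := measure_ne_top _ _
    rcases le_total a b with hab | hab
    · rw [max_eq_right hab, tsub_eq_zero_of_le hab]
      -- The ratio `b / b` is 1 unless the fibre is null for both measures, where it is `0 / 0` but
      -- multiplies zero mass.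
      rcases eq_or_ne b 0 with hb | hb
      · have : a = 0 := le_antisymm (hb ▸ hab) zero_le
        simp [this]
      · rw [ENNReal.div_self hb (measure_ne_top _ _)]; simp
    · rw [max_eq_left hab]
      rcases eq_or_ne a 0 with h0 | h0
      · simp [h0]
      · rw [ENNReal.sub_mul (fun _ _ => ha'), one_mul, ENNReal.div_mul_cancel h0 ha']
  · intro j hj
    rw [Measure.smul_apply, Measure.restrict_apply (hQ i)]
    have : f ⁻¹' {i} ∩ f ⁻¹' {j} = ∅ := by
      ext x; simp only [Set.mem_inter_iff, Set.mem_preimage, Set.mem_singleton_iff,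
        Set.mem_empty_iff_false, iff_false, not_and]
      rintro rfl h; exact hj h.symm
    simp [this]

/-- Two finite measures can be matched inside the fibres of a countable-valued map, so that the
residuals have the least possible mass on each fibre. -/
theorem exists_fiber_matching [Countable ι] [MeasurableSpace ι] [MeasurableSingletonClass ι]
    {f : X → ι} (hf : Measurable f) (α β : Measure X) [IsFiniteMeasure α] [IsFiniteMeasure β] :
    ∃ (γ : Measure (X × X)) (α' β' : Measure X),
      γ.map Prod.fst + α' = α ∧ γ.map Prod.snd + β' = β ∧ (∀ᵐ z ∂γ, f z.1 = f z.2) ∧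
      (∀ i, α' (f ⁻¹' {i}) = α (f ⁻¹' {i}) - β (f ⁻¹' {i})) ∧
      ∀ i, β' (f ⁻¹' {i}) = β (f ⁻¹' {i}) - α (f ⁻¹' {i}) :=
  ⟨fiberMatching f α β, fiberResidual f α β, fiberResidual f β α,
    by rw [fiberMatching_map_fst, fiber_add_residual hf],
    by rw [fiberMatching_map_snd, fiber_add_residual hf],
    fiberMatching_ae hf α β, fiberResidual_fiber hf α β, fiberResidual_fiber hf β α⟩

/-- Mass matched within fibres of `g` contributes equally to both marginals and cancels. The
excesses on coarser cells can thus be computed from the residuals alone, which keeps the induction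
below going. -/
theorem measure_preimage_sub_eq_of_matching {κ : Type*} [MeasurableSpace κ]
    [MeasurableSingletonClass κ] {γ : Measure (X × X)}
    {α β α' β' : Measure X} [IsFiniteMeasure α] {g : X → κ} (hg : Measurable g)
    (h1 : γ.map Prod.fst + α' = α) (h2 : γ.map Prod.snd + β' = β)
    (h : ∀ᵐ z ∂γ, g z.1 = g z.2) (i : κ) :
    α (g ⁻¹' {i}) - β (g ⁻¹' {i}) = α' (g ⁻¹' {i}) - β' (g ⁻¹' {i}) ∧
    β (g ⁻¹' {i}) - α (g ⁻¹' {i}) = β' (g ⁻¹' {i}) - α' (g ⁻¹' {i}) := by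
  have hQ : MeasurableSet (g ⁻¹' {i}) := hg (measurableSet_singleton i)
  have e : γ.map Prod.fst (g ⁻¹' {i}) = γ.map Prod.snd (g ⁻¹' {i}) := by
    rw [Measure.map_apply measurable_fst hQ, Measure.map_apply measurable_snd hQ]
    apply measure_congr
    filter_upwards [h] with z hz
    apply propext
    change g z.1 = i ↔ g z.2 = i
    rw [hz]
  have hfin : γ.map Prod.fst (g ⁻¹' {i}) ≠ ∞ := by
    refine ne_top_of_le_ne_top (measure_ne_top α (g ⁻¹' {i})) ?_
    rw [← h1]; simp
  rw [← h1, ← h2, Measure.add_apply, Measure.add_apply, ← e,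
    ENNReal.add_sub_add_eq_sub_left hfin, ENNReal.add_sub_add_eq_sub_left hfin]
  exact ⟨rfl, rfl⟩

theorem lintegral_fiber [Countable ι] [MeasurableSpace ι] [MeasurableSingletonClass ι]
    {f : X → ι} (hf : Measurable f) (α : Measure X) (w : ι → ℝ≥0∞) :
    ∫⁻ x, w (f x) ∂α = ∑' i, w i * α (f ⁻¹' {i}) := by
  have hw : Measurable w := measurable_of_countable _
  rw [← lintegral_map hw hf, lintegral_countable']
  exact tsum_congr fun i => by rw [Measure.map_apply hf (measurableSet_singleton i)]

/-- The symmetric difference `|a - b|` of two extended nonnegative reals. -/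
noncomputable def absDiff (a b : ℝ≥0∞) : ℝ≥0∞ := (a - b) + (b - a)

/-- Induction on the level: the residuals left at level `N` are matched inside the cells of level `N
+ 1`. Their masses on a cell of level `N` are the two one-sided excesses, which add up to `absDiff`.
This is why the cost of a pair matched at level `i + 1` is charged to its cells of level `i`. -/
theorem exists_partial_matching [Countable ι] [MeasurableSpace ι] [MeasurableSingletonClass ι]
    {h : ℕ → X → ι} (hm : ∀ i, Measurable (h i))
    (hc : ∀ i x y, h i x = h i y → h (i + 1) x = h (i + 1) y)
    (c : X × X → ℝ≥0∞) (w₀ : ι → ℝ≥0∞) (w : ℕ → ι → ℝ≥0∞)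
    (h₀ : ∀ x y, h 0 x = h 0 y → c (x, y) ≤ w₀ (h 0 y))
    (hw : ∀ i x y, h (i + 1) x = h (i + 1) y → c (x, y) ≤ w i (h i x) + w i (h i y))
    (α β : Measure X) [IsFiniteMeasure α] [IsFiniteMeasure β] (N : ℕ) :
    ∃ (γ : Measure (X × X)) (α' β' : Measure X),
      γ.map Prod.fst + α' = α ∧ γ.map Prod.snd + β' = β ∧ (∀ᵐ z ∂γ, h N z.1 = h N z.2) ∧
      (∀ i, α' (h N ⁻¹' {i}) = α (h N ⁻¹' {i}) - β (h N ⁻¹' {i})) ∧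
      (∀ i, β' (h N ⁻¹' {i}) = β (h N ⁻¹' {i}) - α (h N ⁻¹' {i})) ∧
      ∫⁻ z, c z ∂γ ≤ ∫⁻ y, w₀ (h 0 y) ∂β +
        ∑ i ∈ Finset.range N, ∑' Q, w i Q * absDiff (α (h i ⁻¹' {Q})) (β (h i ⁻¹' {Q})) := by
  have hmw : ∀ (w : ι → ℝ≥0∞) (i : ℕ), Measurable fun x => w (h i x) := fun w i =>
    (measurable_of_countable w).comp (hm i)
  induction N with
  | zero =>
    obtain ⟨γ, α', β', e1, e2, e3, e4, e5⟩ := exists_fiber_matching (hm 0) α β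
    refine ⟨γ, α', β', e1, e2, e3, e4, e5, ?_⟩
    calc ∫⁻ z, c z ∂γ ≤ ∫⁻ z, w₀ (h 0 z.2) ∂γ :=
          lintegral_mono_ae (e3.mono fun z hz => h₀ z.1 z.2 hz)
      _ = ∫⁻ y, w₀ (h 0 y) ∂(γ.map Prod.snd) := by
          rw [lintegral_map (hmw w₀ 0) measurable_snd]
      _ ≤ ∫⁻ y, w₀ (h 0 y) ∂β := by
          apply lintegral_mono' _ le_rfl
          rw [← e2]; exact Measure.le_add_right le_rfl
      _ ≤ _ := by simp
  | succ N ih =>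
    obtain ⟨γ, α', β', e1, e2, e3, e4, e5, e6⟩ := ih
    have : IsFiniteMeasure α' := by
      refine isFiniteMeasure_of_le α ?_
      rw [← e1]; exact Measure.le_add_left le_rfl
    have : IsFiniteMeasure β' := by
      refine isFiniteMeasure_of_le β ?_
      rw [← e2]; exact Measure.le_add_left le_rfl
    obtain ⟨δ, α'', β'', f1, f2, f3, f4, f5⟩ := exists_fiber_matching (hm (N + 1)) α' β'
    have e3' : ∀ᵐ z ∂γ, h (N + 1) z.1 = h (N + 1) z.2 := e3.mono fun z hz => hc N _ _ hz
    have key := measure_preimage_sub_eq_of_matching (hm (N + 1)) e1 e2 e3'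
    refine ⟨γ + δ, α'', β'', ?_, ?_, ?_, ?_, ?_, ?_⟩
    · rw [Measure.map_add _ _ measurable_fst, add_assoc, f1, e1]
    · rw [Measure.map_add _ _ measurable_snd, add_assoc, f2, e2]
    · rw [ae_add_measure_iff]; exact ⟨e3', f3⟩
    · intro i; rw [f4, (key i).1]
    · intro i; rw [f5, (key i).2]
    · rw [lintegral_add_measure, Finset.sum_range_succ, ← add_assoc]
      refine add_le_add e6 ?_
      calc ∫⁻ z, c z ∂δ ≤ ∫⁻ z, w N (h N z.1) + w N (h N z.2) ∂δ :=
            lintegral_mono_ae (f3.mono fun z hz => hw N z.1 z.2 hz)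
        _ = ∫⁻ x, w N (h N x) ∂(δ.map Prod.fst) + ∫⁻ x, w N (h N x) ∂(δ.map Prod.snd) := by
            rw [lintegral_add_left (f := fun z : X × X => w N (h N z.1))
              ((hmw (w N) N).comp measurable_fst),
              lintegral_map (hmw _ N) measurable_fst,
              lintegral_map (hmw _ N) measurable_snd]
        _ ≤ ∫⁻ x, w N (h N x) ∂α' + ∫⁻ x, w N (h N x) ∂β' := by
            refine add_le_add (lintegral_mono' ?_ le_rfl) (lintegral_mono' ?_ le_rfl)
            · rw [← f1]; exact Measure.le_add_right le_rfl
            · rw [← f2]; exact Measure.le_add_right le_rfl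
        _ = _ := by
            rw [lintegral_fiber (hm N), lintegral_fiber (hm N), ← ENNReal.tsum_add]
            refine tsum_congr fun i => ?_
            rw [e4, e5, ← mul_add, absDiff]

/-- Hierarchical transport bound: a coupling obtained by matching greedily inside the cells of
successively coarser partitions. -/
theorem exists_coupling_le [Countable ι] [MeasurableSpace ι] [MeasurableSingletonClass ι]
    {h : ℕ → X → ι} (hm : ∀ i, Measurable (h i))
    (hc : ∀ i x y, h i x = h i y → h (i + 1) x = h (i + 1) y)
    (c : X × X → ℝ≥0∞) (w₀ : ι → ℝ≥0∞) (w : ℕ → ι → ℝ≥0∞)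
    (h₀ : ∀ x y, h 0 x = h 0 y → c (x, y) ≤ w₀ (h 0 y))
    (hw : ∀ i x y, h (i + 1) x = h (i + 1) y → c (x, y) ≤ w i (h i x) + w i (h i y))
    (α β : Measure X) [IsProbabilityMeasure α] [IsProbabilityMeasure β] (N : ℕ)
    (a : ι) (hN : ∀ x, h N x = a) :
    ∃ γ : Measure (X × X), IsCoupling γ α β ∧
      ∫⁻ z, c z ∂γ ≤ ∫⁻ y, w₀ (h 0 y) ∂β +
        ∑ i ∈ Finset.range N, ∑' Q, w i Q * absDiff (α (h i ⁻¹' {Q})) (β (h i ⁻¹' {Q})) := by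
  obtain ⟨γ, α', β', e1, e2, -, e4, e5, e6⟩ := exists_partial_matching hm hc c w₀ w h₀ hw α β N
  -- At the top level there is a single cell, on which two probability measures have no excess.
  have hU : h N ⁻¹' {a} = Set.univ := by ext x; simp [hN x]
  have z1 : α' = 0 := by
    have := e4 a
    rwa [hU, measure_univ (μ := α), measure_univ (μ := β), tsub_self,
      Measure.measure_univ_eq_zero] at this
  have z2 : β' = 0 := by
    have := e5 a
    rwa [hU, measure_univ (μ := α), measure_univ (μ := β), tsub_self,
      Measure.measure_univ_eq_zero] at this
  rw [z1, add_zero] at e1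
  rw [z2, add_zero] at e2
  exact ⟨γ, ⟨e1, e2⟩, e6⟩

end Coupling

/-! ### Auerbach coordinates -/

section Auerbach

/-- Coordinates with respect to an Auerbach basis: they are bounded by the norm, which they bound
up to the dimension. -/
theorem exists_auerbach_coordinates {E : Type*} [NormedAddCommGroup E] [NormedSpace ℝ E]
    [FiniteDimensional ℝ E] {d : ℕ} (hd : Module.finrank ℝ E = d) :
    ∃ L : E →ₗ[ℝ] (Fin d → ℝ), (∀ x i, |L x i| ≤ ‖x‖) ∧ ∀ x, ‖x‖ ≤ d * ‖L x‖ := by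
  classical
  have : ProperSpace E := FiniteDimensional.proper ℝ E
  let b : Module.Basis (Fin d) ℝ E := Module.finBasisOfFinrankEq ℝ E hd
  -- The basis is a tuple of vectors of the unit ball maximising the absolute determinant.
  let K : Set (Fin d → E) := Set.pi Set.univ fun _ => Metric.closedBall (0 : E) 1
  have hK : IsCompact K := isCompact_univ_pi fun _ => isCompact_closedBall _ _
  have hcont : Continuous fun v : Fin d → E => |b.det v| := by
    apply Continuous.abs
    change Continuous fun v : Fin d → E => (b.toMatrix v).det
    apply Continuous.matrix_det
    refine continuous_matrix fun i j => ?_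
    change Continuous fun v : Fin d → E => b.repr (v j) i
    have h1 : Continuous (b.coord i) := LinearMap.continuous_of_finiteDimensional _
    exact h1.comp (continuous_apply j)
  obtain ⟨v, hvK, hv⟩ := hK.exists_isMaxOn ⟨0, by simp [K]⟩ hcont.continuousOn
  have hvn : ∀ i, ‖v i‖ ≤ 1 := fun i => by
    have := hvK i (Set.mem_univ i)
    simpa using this
  have hpos : b.det v ≠ 0 := by
    -- The normalised reference basis competes, so the maximum is not zero and the maximiser is a
    -- basis.
    let w : Fin d → E := fun i => (‖b i‖⁻¹ : ℝ) • b i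
    have hw : w ∈ K := by
      intro i _
      have h0 : ‖b i‖ ≠ 0 := norm_ne_zero_iff.2 (b.ne_zero i)
      simp [w, norm_smul, h0]
    have hw' : b.det w ≠ 0 := by
      have : b.det w = (∏ i, ‖b i‖⁻¹) • b.det b := AlternatingMap.map_smul_univ _ _ _
      rw [this, Module.Basis.det_self, smul_eq_mul, mul_one]
      exact Finset.prod_ne_zero_iff.2 fun i _ => inv_ne_zero (norm_ne_zero_iff.2 (b.ne_zero i))
    have h1 : |b.det w| ≤ |b.det v| := hv hw
    intro h0
    rw [h0, abs_zero] at h1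
    exact hw' (abs_nonpos_iff.1 h1)
  obtain ⟨hli, hsp⟩ := (Module.Basis.is_basis_iff_det b).2 (isUnit_iff_ne_zero.2 hpos)
  let e : Module.Basis (Fin d) ℝ E := Module.Basis.mk hli hsp.ge
  have hev : ⇑e = v := Module.Basis.coe_mk _ _
  -- Cramer's rule: replacing the `i`-th basis vector by `x` multiplies the determinant by the
  -- `i`-th coordinate of `x`. Maximality then bounds that coordinate by 1 on the unit ball.
  have hdet : ∀ x i, b.det (Function.update v i x) = b.det v * e.repr x i := by
    intro x i
    have h1 : b.det = b.det e • e.det := AlternatingMap.eq_smul_basis_det e b.det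
    rw [h1]
    have h2 : e.det (Function.update v i x) = e.repr x i := by
      rw [← hev, Module.Basis.det_apply, Module.Basis.toMatrix_update,
        Module.Basis.toMatrix_self, ← Matrix.cramer_apply, Matrix.cramer_one]
      rfl
    rw [AlternatingMap.smul_apply, AlternatingMap.smul_apply, h2]
    conv_rhs => rw [← hev, Module.Basis.det_self]
    simp
  have hball : ∀ x, ‖x‖ ≤ 1 → ∀ i, |e.repr x i| ≤ 1 := by
    intro x hx i
    have hm : Function.update v i x ∈ K := by
      intro j _
      by_cases hj : j = i
      · subst hj; simpa using hx
      · simpa [Function.update_of_ne hj] using hvn j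
    have h1 : |b.det (Function.update v i x)| ≤ |b.det v| := hv hm
    rw [hdet, abs_mul] at h1
    have h2 : 0 < |b.det v| := abs_pos.2 hpos
    nlinarith
  refine ⟨e.equivFun.toLinearMap, fun x i => ?_, fun x => ?_⟩
  · rcases eq_or_ne x 0 with rfl | hx
    · simp
    · have h0 : 0 < ‖x‖ := norm_pos_iff.2 hx
      have h1 := hball ((‖x‖⁻¹ : ℝ) • x) (by simp [norm_smul, h0.ne']) i
      rw [map_smul, Finsupp.smul_apply, smul_eq_mul, abs_mul, abs_inv, abs_norm,
        inv_mul_le_iff₀ h0, mul_one] at h1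
      exact h1
  · calc ‖x‖ = ‖∑ i, e.equivFun x i • e i‖ := by rw [e.sum_equivFun]
      _ ≤ ∑ i, ‖e.equivFun x i • e i‖ := norm_sum_le _ _
      _ ≤ ∑ _i : Fin d, ‖e.equivFun x‖ := by
          refine Finset.sum_le_sum fun i _ => ?_
          rw [norm_smul, hev]
          calc ‖e.equivFun x i‖ * ‖v i‖ ≤ ‖e.equivFun x i‖ * 1 := by
                gcongr; exact hvn i
            _ ≤ _ := by rw [mul_one]; exact norm_le_pi_norm _ i
      _ = d * ‖e.equivFun x‖ := by simp

end Auerbach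

/-! ### Dyadic shells and cells -/

section Cells

variable {E : Type*} [NormedAddCommGroup E]

/-- The index `k` of the dyadic shell `M 2 ^ (k - 1) < ‖x - e‖ ≤ M 2 ^ k` containing `x`; the index
of the ball `‖x - e‖ ≤ M` is `0`. -/
noncomputable def shell (e : E) (M : ℝ) (x : E) : ℕ := ⌈Real.logb 2 (‖x - e‖ / M)⌉₊

theorem norm_sub_le_shell (e : E) {M : ℝ} (hM : 0 < M) (x : E) :
    ‖x - e‖ ≤ M * 2 ^ shell e M x := by
  rcases eq_or_ne (x - e) 0 with h | h
  · rw [h, norm_zero]; positivity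
  · have h0 : 0 < ‖x - e‖ / M := div_pos (norm_pos_iff.2 h) hM
    have h1 : Real.logb 2 (‖x - e‖ / M) ≤ (shell e M x : ℝ) := Nat.le_ceil _
    rw [Real.logb_le_iff_le_rpow one_lt_two h0, Real.rpow_natCast, div_le_iff₀ hM] at h1
    linarith

theorem shell_lt_norm_sub (e : E) {M : ℝ} (hM : 0 < M) {x : E} (hx : 0 < shell e M x) :
    M * 2 ^ shell e M x < 2 * ‖x - e‖ := by
  have hl : 0 < Real.logb 2 (‖x - e‖ / M) := Nat.ceil_pos.1 hx
  -- The default value `log 0 = 0` places the centre in shell 0, which is excluded here.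
  have hne : ‖x - e‖ / M ≠ 0 := fun h => by rw [h, Real.logb_zero] at hl; exact lt_irrefl _ hl
  have h0 : 0 < ‖x - e‖ / M := lt_of_le_of_ne (by positivity) hne.symm
  have h1 : (shell e M x : ℝ) < Real.logb 2 (‖x - e‖ / M) + 1 := Nat.ceil_lt_add_one hl.le
  have h2 : (shell e M x : ℝ) - 1 < Real.logb 2 (‖x - e‖ / M) := by linarith
  rw [Real.lt_logb_iff_rpow_lt one_lt_two h0, Real.rpow_sub two_pos, Real.rpow_natCast,
    Real.rpow_one, lt_div_iff₀ hM] at h2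
  linarith

theorem measurable_shell [MeasurableSpace E] [BorelSpace E] (e : E) (M : ℝ) :
    Measurable (shell e M) := by
  refine Nat.measurable_ceil.comp ?_
  have : Continuous fun x : E => ‖x - e‖ / M := by fun_prop
  exact (Real.measurable_log.comp this.measurable).div_const _

variable [NormedSpace ℝ E] {d : ℕ}

/-- The dyadic cell of generation `j` containing `x`, with respect to the coordinates `L`. Cells of
generation `j` in the shell `k` have side length `M 2 ^ k / 2 ^ j`. -/
noncomputable def cell (L : E →ₗ[ℝ] (Fin d → ℝ)) (e : E) (M : ℝ) (j : ℕ) (x : E) :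
    ℕ × (Fin d → ℤ) :=
  (shell e M x, fun i => ⌊2 ^ j * (L (x - e) i / (M * 2 ^ shell e M x))⌋)

theorem measurable_cell [FiniteDimensional ℝ E] [MeasurableSpace E] [BorelSpace E]
    (L : E →ₗ[ℝ] (Fin d → ℝ)) (e : E) (M : ℝ) (j : ℕ) : Measurable (cell L e M j) := by
  refine (measurable_shell e M).prodMk (measurable_pi_lambda _ fun i => Int.measurable_floor.comp ?_)
  have hL : Continuous L := LinearMap.continuous_of_finiteDimensional L
  have h1 : Measurable fun x : E => L (x - e) i := by
    have : Continuous fun x : E => L (x - e) i :=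
      (continuous_apply i).comp (hL.comp (continuous_id.sub continuous_const))
    exact this.measurable
  have h2 : Measurable fun x : E => (2 : ℝ) ^ shell e M x :=
    (measurable_of_countable fun k : ℕ => (2 : ℝ) ^ k).comp (measurable_shell e M)
  exact measurable_const.mul (h1.div (measurable_const.mul h2))

/-- The floor at scale `j` is the integer half of the floor at scale `j + 1`, so the partitions are
nested. -/
theorem floor_two_pow_eq_of_succ {a b : ℝ} {j : ℕ} (h : ⌊2 ^ (j + 1) * a⌋ = ⌊2 ^ (j + 1) * b⌋) :
    ⌊2 ^ j * a⌋ = ⌊2 ^ j * b⌋ := by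
  have key : ∀ a : ℝ, ⌊(2 : ℝ) ^ j * a⌋ = ⌊(2 : ℝ) ^ (j + 1) * a⌋ / (2 : ℕ) := by
    intro a
    rw [← Int.floor_div_natCast]
    congr 1
    push_cast
    ring
  rw [key, key, h]

theorem cell_eq_of_succ {L : E →ₗ[ℝ] (Fin d → ℝ)} {e : E} {M : ℝ} {j : ℕ} {x y : E}
    (h : cell L e M (j + 1) x = cell L e M (j + 1) y) : cell L e M j x = cell L e M j y := by
  have h1 : shell e M x = shell e M y := congrArg Prod.fst h
  have h2 := congrArg Prod.snd h
  refine Prod.ext h1 (funext fun i => ?_)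
  exact floor_two_pow_eq_of_succ (congrFun h2 i)

theorem norm_sub_le_of_cell_eq {L : E →ₗ[ℝ] (Fin d → ℝ)} (hL : ∀ x, ‖x‖ ≤ d * ‖L x‖)
    {e : E} {M : ℝ} (hM : 0 < M) {j : ℕ} {x y : E} (h : cell L e M j x = cell L e M j y) :
    ‖x - y‖ ≤ d * (M * (2 ^ shell e M y / 2 ^ j)) := by
  have h1 : shell e M x = shell e M y := congrArg Prod.fst h
  have h2 := congrArg Prod.snd h
  refine (hL (x - y)).trans ?_
  gcongr
  rw [pi_norm_le_iff_of_nonneg (by positivity)]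
  intro i
  have h3 := Int.abs_sub_lt_one_of_floor_eq_floor (congrFun h2 i)
  rw [h1, ← mul_sub, ← sub_div, abs_mul, abs_div] at h3
  have e1 : L (x - y) i = L (x - e) i - L (y - e) i := by
    rw [← Pi.sub_apply, ← map_sub, sub_sub_sub_cancel_right]
  have hp : 0 < M * 2 ^ shell e M y := by positivity
  have hj : (0 : ℝ) < 2 ^ j := by positivity
  rw [abs_of_pos hp, abs_of_pos hj, ← mul_div_assoc, div_lt_one hp] at h3
  rw [Real.norm_eq_abs, e1, ← mul_div_assoc, le_div_iff₀ hj]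
  linarith

/-- The possible positions of cells of generation `j`. -/
noncomputable def cellPositions (d j : ℕ) : Finset (Fin d → ℤ) :=
  Fintype.piFinset fun _ => Finset.Icc (-2 ^ j) (2 ^ j)

theorem cell_snd_mem {L : E →ₗ[ℝ] (Fin d → ℝ)} (hL : ∀ x i, |L x i| ≤ ‖x‖)
    (e : E) {M : ℝ} (hM : 0 < M) (j : ℕ) (x : E) : (cell L e M j x).2 ∈ cellPositions d j := by
  rw [cellPositions, Fintype.mem_piFinset]
  intro i
  have hp : 0 < M * 2 ^ shell e M x := by positivity
  have hj : (0 : ℝ) < 2 ^ j := by positivity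
  have h1 : |L (x - e) i / (M * 2 ^ shell e M x)| ≤ 1 := by
    rw [abs_div, abs_of_pos hp, div_le_one hp]
    exact (hL _ i).trans (norm_sub_le_shell e hM x)
  rw [abs_le] at h1
  rw [Finset.mem_Icc]
  change -2 ^ j ≤ ⌊2 ^ j * (L (x - e) i / (M * 2 ^ shell e M x))⌋ ∧
    ⌊2 ^ j * (L (x - e) i / (M * 2 ^ shell e M x))⌋ ≤ 2 ^ j
  constructor
  · rw [Int.le_floor]; push_cast; nlinarith
  · have : ((⌊2 ^ j * (L (x - e) i / (M * 2 ^ shell e M x))⌋ : ℤ) : ℝ) ≤ ((2 ^ j : ℤ) : ℝ) := by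
      refine (Int.floor_le _).trans ?_
      push_cast; nlinarith
    exact_mod_cast this

/-- Each coordinate has `2^(j+1) + 1` possible values, since the endpoint `2^j` can occur; `2^(j+2)`
is a convenient upper bound. -/
theorem card_cellPositions_le (d j : ℕ) : (cellPositions d j).card ≤ 2 ^ ((j + 2) * d) := by
  rw [cellPositions, Fintype.card_piFinset]
  simp only [Int.card_Icc, Finset.prod_const, Finset.card_univ, Fintype.card_fin]
  rw [pow_mul]
  refine Nat.pow_le_pow_left ?_ d
  have h1 : (1 : ℤ) ≤ 2 ^ j := one_le_pow₀ (by norm_num)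
  have : (2 : ℤ) ^ j + 1 - -2 ^ j ≤ ((2 ^ (j + 2) : ℕ) : ℤ) := by push_cast; rw [pow_add]; linarith
  omega

end Cells

/-! ### Multiscale upper bound for the Wasserstein distance -/

section Bound

theorem edist_rpow_le {E : Type*} [SeminormedAddCommGroup E] {p : ℝ} (hp : 0 < p) {x y : E} {a b : ℝ} (hb : 0 ≤ b)
    (ha : 0 ≤ a) (h : ‖x - y‖ ≤ a * b) :
    edist x y ^ p ≤ ENNReal.ofReal (a ^ p * b ^ p) := by
  rw [edist_dist, dist_eq_norm, ENNReal.ofReal_rpow_of_nonneg (norm_nonneg _) hp.le,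
    ← Real.mul_rpow ha hb]
  exact ENNReal.ofReal_le_ofReal (Real.rpow_le_rpow (norm_nonneg _) h hp.le)

variable {E : Type*} [NormedAddCommGroup E] [NormedSpace ℝ E] {d : ℕ} [MeasurableSpace E]

/-- The cost `(2 ^ k / 2 ^ j) ^ p` attached to cells of generation `j` in the shell `k`. -/
noncomputable def cellWeight (p : ℝ) (k j : ℕ) : ℝ := ((2 : ℝ) ^ k / 2 ^ j) ^ p

theorem cellWeight_pos (p : ℝ) (k j : ℕ) : 0 < cellWeight p k j := by
  unfold cellWeight; positivity

/-- The multiscale distance `∑_{j ≤ J} ∑_Q (2 ^ k(Q) / 2 ^ j) ^ p |α Q - β Q|`. -/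
noncomputable def cellSum (L : E →ₗ[ℝ] (Fin d → ℝ)) (e : E) (M p : ℝ) (J : ℕ) (α β : Measure E) :
    ℝ≥0∞ :=
  ∑ j ∈ Finset.range (J + 1), ∑' Q : ℕ × (Fin d → ℤ), ENNReal.ofReal (cellWeight p Q.1 j) *
    absDiff (α (cell L e M j ⁻¹' {Q})) (β (cell L e M j ⁻¹' {Q}))

theorem wasserstein_rpow_le {X : Type*} [PseudoEMetricSpace X] [MeasurableSpace X] {p : ℝ}
    (hp : 0 < p) {μ ν : Measure X} {γ : Measure (X × X)} (h : IsCoupling γ μ ν) :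
    wasserstein p μ ν ^ p ≤ ∫⁻ z, edist z.1 z.2 ^ p ∂γ := by
  calc wasserstein p μ ν ^ p ≤ ((∫⁻ z, edist z.1 z.2 ^ p ∂γ) ^ (1 / p)) ^ p :=
        ENNReal.rpow_le_rpow (iInf₂_le γ h) hp.le
    _ = _ := by rw [← ENNReal.rpow_mul, one_div_mul_cancel hp.ne', ENNReal.rpow_one]

/-- Hierarchical matching through generations `J, J - 1, …, 0` and finally the whole space. Pairs
matched in the finest cells pay the integral term. A pair matched one generation above its leftover
cell is at most twice that cell's diameter bound apart, whence the 2 in `2 * d * M`. -/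
theorem wasserstein_rpow_le_cellSum [FiniteDimensional ℝ E] [BorelSpace E]
    {L : E →ₗ[ℝ] (Fin d → ℝ)} (hL : ∀ x, ‖x‖ ≤ d * ‖L x‖) (hd : 1 ≤ d) (e : E) {M : ℝ}
    (hM : 0 < M) {p : ℝ} (hp : 0 < p) (J : ℕ) (α β : Measure E) [IsProbabilityMeasure α]
    [IsProbabilityMeasure β] :
    wasserstein p α β ^ p ≤ ENNReal.ofReal ((2 * d * M) ^ p) *
      (∫⁻ y, ENNReal.ofReal (cellWeight p (shell e M y) J) ∂β + cellSum L e M p J α β) := by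
  have hd' : (1 : ℝ) ≤ d := by exact_mod_cast hd
  -- Level `i` is generation `J - i`; from level `J + 1` on all points share the single label 0.
  let h : ℕ → E → ℕ × (Fin d → ℤ) := fun i x => if i ≤ J then cell L e M (J - i) x else 0
  let W : ℕ → ℕ × (Fin d → ℤ) → ℝ≥0∞ := fun j Q =>
    ENNReal.ofReal ((2 * d * M) ^ p * cellWeight p Q.1 j)
  have hA : 0 ≤ 2 * d * M := by positivity
  have hAp : 0 ≤ (2 * d * M) ^ p := by positivity
  have hm : ∀ i, Measurable (h i) := by
    intro i
    by_cases hi : i ≤ J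
    · simpa only [h, hi, if_true] using measurable_cell L e M (J - i)
    · simpa only [h, hi, if_false] using measurable_const
  have hc : ∀ i x y, h i x = h i y → h (i + 1) x = h (i + 1) y := by
    intro i x y hxy
    by_cases hi : i + 1 ≤ J
    · have hi' : i ≤ J := by omega
      simp only [h, hi, hi', if_true] at hxy ⊢
      refine cell_eq_of_succ ?_
      rwa [show J - (i + 1) + 1 = J - i by omega]
    · simp only [h, hi, if_false]
  obtain ⟨γ, hγ, hle⟩ := exists_coupling_le hm hc (fun z => edist z.1 z.2 ^ p) (W J)
    (fun i => if i ≤ J then W (J - i) else ⊤) (by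
      intro x y hxy
      simp only [h, zero_le, if_true, Nat.sub_zero] at hxy ⊢
      have := norm_sub_le_of_cell_eq hL hM hxy
      refine edist_rpow_le hp (by positivity) hA (this.trans ?_)
      have h2 : 0 ≤ d * (M * ((2 : ℝ) ^ shell e M y / 2 ^ J)) := by positivity
      change _ ≤ 2 * d * M * (2 ^ shell e M y / 2 ^ J)
      linarith) (by
      intro i x y hxy
      by_cases hi : i ≤ J
      · simp only [hi, if_true]
        have hx1 : (h i x).1 = shell e M x := by simp only [h, hi, if_true]; rfl
        have hy1 : (h i y).1 = shell e M y := by simp only [h, hi, if_true]; rfl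
        by_cases hi2 : i + 1 ≤ J
        · refine le_trans ?_ le_add_self
          simp only [h, hi2, if_true] at hxy
          have := norm_sub_le_of_cell_eq hL hM hxy
          refine edist_rpow_le hp (by positivity) hA (this.trans ?_)
          rw [hy1, show J - i = J - (i + 1) + 1 by omega, pow_succ]
          apply le_of_eq
          field_simp
        -- In the last step the points may lie in different shells. The triangle inequality through
        -- `e` bounds their distance by twice the larger shell radius, charged to the point in the
        -- larger shell.
        · have hij : J - i = 0 := by omega
          have h3 : ‖x - y‖ ≤ M * 2 ^ shell e M x + M * 2 ^ shell e M y := by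
            have := norm_sub_le_norm_sub_add_norm_sub x e y
            have h4 := norm_sub_le_shell e hM x
            have h5 := norm_sub_le_shell e hM y
            rw [norm_sub_rev e y] at this
            linarith
          have key : ∀ k : ℕ, ‖x - y‖ ≤ 2 * (M * 2 ^ k) → ‖x - y‖ ≤ 2 * d * M * (2 ^ k / 2 ^ 0) := by
            intro k hk
            have : 0 ≤ 2 * (M * (2 : ℝ) ^ k) := by positivity
            rw [pow_zero, div_one]
            nlinarith
          rcases le_total (M * (2 : ℝ) ^ shell e M x) (M * 2 ^ shell e M y) with hxy' | hxy'
          · refine le_trans ?_ le_add_self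
            refine edist_rpow_le hp (by positivity) hA ?_
            rw [hy1, hij]
            exact key _ (by linarith)
          · refine le_trans ?_ le_self_add
            refine edist_rpow_le hp (by positivity) hA ?_
            rw [hx1, hij]
            exact key _ (by linarith)
      · simp [hi]) α β (J + 1) 0 (by intro x; simp [h])
  refine (wasserstein_rpow_le hp hγ).trans (hle.trans (le_of_eq ?_))
  rw [mul_add]
  congr 1
  · rw [← lintegral_const_mul']
    · refine lintegral_congr fun y => ?_
      simp only [W, h, zero_le, if_true, Nat.sub_zero]
      exact ENNReal.ofReal_mul hAp
    · exact ENNReal.ofReal_ne_top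
  · rw [cellSum, ← Finset.sum_range_reflect, Finset.mul_sum]
    refine Finset.sum_congr rfl fun i hi => ?_
    have hi' : i ≤ J := by simpa [Nat.lt_succ_iff] using hi
    have hi2 : J + 1 - 1 - i ≤ J := by omega
    rw [← ENNReal.tsum_mul_left]
    refine tsum_congr fun Q => ?_
    simp only [h, hi2, if_true, show J - (J + 1 - 1 - i) = i by omega, W]
    rw [ENNReal.ofReal_mul hAp, mul_assoc]

end Bound

/-! ### Fluctuation of the empirical mass of one set -/

section Empirical

variable {X : Type*} [MeasurableSpace X]

theorem absDiff_eq {a b : ℝ≥0∞} (ha : a ≠ ∞) (hb : b ≠ ∞) :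
    absDiff a b = ENNReal.ofReal |a.toReal - b.toReal| := by
  unfold absDiff
  rcases le_total a b with h | h
  · have h' : a.toReal ≤ b.toReal := ENNReal.toReal_mono hb h
    rw [tsub_eq_zero_of_le h, zero_add, abs_of_nonpos (by linarith), neg_sub,
      ENNReal.ofReal_sub _ ENNReal.toReal_nonneg, ENNReal.ofReal_toReal ha, ENNReal.ofReal_toReal hb]
  · have h' : b.toReal ≤ a.toReal := ENNReal.toReal_mono ha h
    rw [tsub_eq_zero_of_le h, add_zero, abs_of_nonneg (by linarith),
      ENNReal.ofReal_sub _ ENNReal.toReal_nonneg, ENNReal.ofReal_toReal ha, ENNReal.ofReal_toReal hb]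

theorem absDiff_le_add (a b : ℝ≥0∞) : absDiff a b ≤ a + b :=
  add_le_add tsub_le_self tsub_le_self

theorem absDiff_zero : absDiff 0 0 = 0 := by simp [absDiff]

theorem empiricalMeasure_apply {n : ℕ} (x : Fin n → X) {Q : Set X} (hQ : MeasurableSet Q) :
    empiricalMeasure x Q = (n : ℝ≥0∞)⁻¹ * ∑ i, Q.indicator 1 (x i) := by
  simp [empiricalMeasure, Measure.dirac_apply' _ hQ]

theorem isProbabilityMeasure_empiricalMeasure {n : ℕ} (hn : 0 < n) (x : Fin n → X) :
    IsProbabilityMeasure (empiricalMeasure x) := by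
  constructor
  rw [empiricalMeasure_apply x MeasurableSet.univ]
  simp [ENNReal.inv_mul_cancel, hn.ne']

theorem empiricalMeasure_real {n : ℕ} (x : Fin n → X) {Q : Set X}
    (hQ : MeasurableSet Q) :
    (empiricalMeasure x Q).toReal = (∑ i, Q.indicator (1 : X → ℝ) (x i)) / n := by
  rw [empiricalMeasure_apply x hQ, ENNReal.toReal_mul, ENNReal.toReal_inv, ENNReal.toReal_natCast,
    ENNReal.toReal_sum, div_eq_inv_mul]
  · congr 1
    refine Finset.sum_congr rfl fun i _ => ?_
    by_cases h : x i ∈ Q <;> simp [h]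
  · intro i _
    by_cases h : x i ∈ Q <;> simp [h]

theorem empiricalMeasure_ne_top {n : ℕ} (hn : 0 < n) (x : Fin n → X) (Q : Set X) :
    empiricalMeasure x Q ≠ ∞ :=
  have := isProbabilityMeasure_empiricalMeasure hn x
  measure_ne_top _ _

variable {Ω : Type*} [MeasurableSpace Ω] {P : Measure Ω} [IsProbabilityMeasure P]
  {μ : Measure X} [IsProbabilityMeasure μ] {n : ℕ} {x : Fin n → Ω → X}

theorem IsIIDSample.measurable_empiricalMeasure (hx : IsIIDSample P μ x) {Q : Set X}
    (hQ : MeasurableSet Q) : Measurable fun ω => empiricalMeasure (fun i => x i ω) Q := by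
  simp_rw [empiricalMeasure_apply _ hQ]
  refine measurable_const.mul (Finset.measurable_sum _ fun i _ => ?_)
  exact (measurable_one.indicator hQ).comp (hx.measurable i)

theorem measurable_absDiff_const {f : Ω → ℝ≥0∞} (hf : Measurable f) (b : ℝ≥0∞) :
    Measurable fun ω => absDiff (f ω) b :=
  (hf.sub measurable_const).add (measurable_const.sub hf)

theorem IsIIDSample.integral_indicator (hx : IsIIDSample P μ x) {Q : Set X}
    (hQ : MeasurableSet Q) (i : Fin n) :
    ∫ ω, Q.indicator (1 : X → ℝ) (x i ω) ∂P = μ.real Q := by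
  rw [← integral_indicator_one hQ, ← hx.law i, integral_map (hx.measurable i).aemeasurable]
  exact (measurable_one.indicator hQ).aestronglyMeasurable

theorem IsIIDSample.memLp_indicator (hx : IsIIDSample P μ x) {Q : Set X}
    (hQ : MeasurableSet Q) (i : Fin n) (r : ℝ≥0∞) :
    MemLp (fun ω => Q.indicator (1 : X → ℝ) (x i ω)) r P := by
  refine MemLp.of_bound
    ((measurable_one.indicator hQ).comp (hx.measurable i)).aestronglyMeasurable 1 ?_
  refine Filter.Eventually.of_forall fun ω => ?_
  by_cases h : x i ω ∈ Q <;> simp [h]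

theorem IsIIDSample.variance_sum_le (hx : IsIIDSample P μ x) {Q : Set X} (hQ : MeasurableSet Q) :
    Var[fun ω => ∑ i, Q.indicator (1 : X → ℝ) (x i ω); P] ≤ n * μ.real Q := by
  have hmem := fun i => hx.memLp_indicator hQ i 2
  have h1 : Var[∑ i, fun ω => Q.indicator (1 : X → ℝ) (x i ω); P]
      = ∑ i, Var[fun ω => Q.indicator (1 : X → ℝ) (x i ω); P] := by
    refine IndepFun.variance_sum (fun i _ => hmem i) fun i _ j _ hij => ?_
    have := (hx.indep.comp (fun _ => Q.indicator (1 : X → ℝ))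
      (fun _ => measurable_one.indicator hQ)).indepFun hij
    exact this
  have h2 : (fun ω => ∑ i, Q.indicator (1 : X → ℝ) (x i ω))
      = ∑ i, fun ω => Q.indicator (1 : X → ℝ) (x i ω) := by ext ω; simp
  rw [h2, h1]
  calc _ ≤ ∑ _i : Fin n, μ.real Q := by
        refine Finset.sum_le_sum fun i _ => ?_
        rw [variance_eq_sub (hmem i), ← hx.integral_indicator hQ i]
        have : (fun ω => Q.indicator (1 : X → ℝ) (x i ω)) ^ 2
            = fun ω => Q.indicator (1 : X → ℝ) (x i ω) := by
          ext ω; by_cases h : x i ω ∈ Q <;> simp [h]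
        rw [this]
        nlinarith [sq_nonneg (∫ ω, Q.indicator (1 : X → ℝ) (x i ω) ∂P)]
    _ = _ := by simp

theorem sq_integral_abs_le {f : Ω → ℝ} (hf : MemLp f 2 P) :
    (∫ ω, |f ω| ∂P) ^ 2 ≤ ∫ ω, f ω ^ 2 ∂P := by
  have h := variance_nonneg |f| P
  rw [variance_eq_sub hf.abs] at h
  have : ∫ ω, (|f| ^ 2) ω ∂P = ∫ ω, f ω ^ 2 ∂P := by
    refine integral_congr_ae (Filter.Eventually.of_forall fun ω => ?_)
    simp
  rw [this] at h
  simp only [Pi.abs_apply] at h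
  linarith

/-- Write `A = A^(1-s) A^s`, use the linear bound on the first factor and the square-root bound on
the second. The linear bound preserves summability over shells, and the square root supplies the
decay in `N`. -/
theorem le_two_mul_rpow_mul_rpow {A m N s : ℝ} (hA : 0 ≤ A) (hm : 0 ≤ m) (hN : 0 < N) (hs : 0 ≤ s)
    (hs1 : s ≤ 1) (h1 : A ≤ 2 * m) (h2 : A ^ 2 ≤ m / N) :
    A ≤ 2 * m ^ (1 - s / 2) * N ^ (-(s / 2)) := by
  rcases hA.eq_or_lt with rfl | hA
  · positivity
  have hm0 : 0 < m := by linarith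
  have h3 : A ≤ (m / N) ^ (1 / 2 : ℝ) := by
    rw [← Real.sqrt_eq_rpow]; exact Real.le_sqrt_of_sq_le h2
  calc A = A ^ (1 - s) * A ^ s := by rw [← Real.rpow_add hA, sub_add_cancel, Real.rpow_one]
    _ ≤ (2 * m) ^ (1 - s) * ((m / N) ^ (1 / 2 : ℝ)) ^ s := by gcongr
    _ = 2 ^ (1 - s) * (m ^ (1 - s) * m ^ (s / 2)) * N ^ (-(s / 2)) := by
        rw [← Real.rpow_mul (by positivity), Real.mul_rpow two_pos.le hm,
          Real.div_rpow hm hN.le, Real.rpow_neg hN.le, one_div_mul_eq_div]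
        ring
    _ = 2 ^ (1 - s) * m ^ (1 - s / 2) * N ^ (-(s / 2)) := by
        rw [← Real.rpow_add hm0]; ring_nf
    _ ≤ 2 * m ^ (1 - s / 2) * N ^ (-(s / 2)) := by
        gcongr
        calc (2 : ℝ) ^ (1 - s) ≤ 2 ^ (1 : ℝ) := Real.rpow_le_rpow_of_exponent_le one_le_two (by linarith)
          _ = 2 := Real.rpow_one 2

theorem IsIIDSample.lintegral_absDiff_le (hx : IsIIDSample P μ x) (hn : 0 < n) {Q : Set X}
    (hQ : MeasurableSet Q) {s : ℝ} (hs : 0 ≤ s) (hs1 : s ≤ 1) :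
    ∫⁻ ω, absDiff (empiricalMeasure (fun i => x i ω) Q) (μ Q) ∂P
      ≤ ENNReal.ofReal (2 * μ.real Q ^ (1 - s / 2) * (n : ℝ) ^ (-(s / 2))) := by
  have hn' : (0 : ℝ) < n := by exact_mod_cast hn
  set S : Ω → ℝ := fun ω => ∑ i, Q.indicator (1 : X → ℝ) (x i ω) with hS
  have hSmem : MemLp S 2 P := memLp_finsetSum _ fun i _ => hx.memLp_indicator hQ i 2
  have hSint : Integrable S P := hSmem.integrable one_le_two
  have hES : ∫ ω, S ω ∂P = n * μ.real Q := by
    rw [hS, integral_finsetSum _ fun i _ => (hx.memLp_indicator hQ i 2).integrable one_le_two]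
    simp [hx.integral_indicator hQ]
  set F : Ω → ℝ := fun ω => S ω / n - μ.real Q with hF
  have hFmem : MemLp F 2 P := by
    have := hSmem.mul_const (n : ℝ)⁻¹
    simp only [← div_eq_mul_inv] at this
    exact this.sub (memLp_const _)
  have hFint : Integrable F P := hFmem.integrable one_le_two
  have e1 : ∫⁻ ω, absDiff (empiricalMeasure (fun i => x i ω) Q) (μ Q) ∂P
      = ENNReal.ofReal (∫ ω, |F ω| ∂P) := by
    rw [ofReal_integral_eq_lintegral_ofReal hFint.abs
      (Filter.Eventually.of_forall fun ω => abs_nonneg _)]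
    refine lintegral_congr fun ω => ?_
    rw [absDiff_eq (empiricalMeasure_ne_top hn _ _) (measure_ne_top _ _),
      empiricalMeasure_real _ hQ]
    rfl
  rw [e1]
  apply ENNReal.ofReal_le_ofReal
  refine le_two_mul_rpow_mul_rpow (integral_nonneg fun ω => abs_nonneg _) measureReal_nonneg hn' hs
    hs1 ?_ ?_
  · calc ∫ ω, |F ω| ∂P ≤ ∫ ω, S ω / n + μ.real Q ∂P := by
          refine integral_mono hFint.abs ((hSint.div_const _).add (integrable_const _)) fun ω => ?_
          have h1 : 0 ≤ S ω / n := by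
            refine div_nonneg (Finset.sum_nonneg fun i _ => ?_) hn'.le
            exact Set.indicator_nonneg (fun _ _ => zero_le_one) _
          have h2 : 0 ≤ μ.real Q := measureReal_nonneg
          simp only [hF]
          rw [abs_le]; constructor <;> linarith
      _ = 2 * μ.real Q := by
          rw [integral_add (hSint.div_const _) (integrable_const _), integral_div, hES]
          simp only [integral_const, probReal_univ, smul_eq_mul, one_mul]
          field_simp
          ring
  · refine (sq_integral_abs_le hFmem).trans ?_
    have hv : ∫ ω, F ω ^ 2 ∂P = Var[S; P] / n ^ 2 := by
      rw [variance_eq_integral hSmem.aestronglyMeasurable.aemeasurable, hES, ← integral_div]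
      refine integral_congr_ae (Filter.Eventually.of_forall fun ω => ?_)
      simp only [hF]
      field_simp
    rw [hv]
    have := hx.variance_sum_le hQ
    calc Var[S; P] / n ^ 2 ≤ n * μ.real Q / n ^ 2 := by gcongr
      _ = μ.real Q / n := by field_simp

end Empirical

/-! ### Masses of shells under a moment bound -/

section Moment

variable {E : Type*} [NormedAddCommGroup E] [MeasurableSpace E] [BorelSpace E]
  {μ : Measure E} {e : E} {M q : ℝ}

theorem lintegral_edist_rpow_le (hq : 0 < q) (hM : 0 < M)
    (h : momentNorm q e μ ≤ ENNReal.ofReal M) :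
    ∫⁻ x, edist e x ^ q ∂μ ≤ ENNReal.ofReal (M ^ q) := by
  rw [momentNorm, one_div, ENNReal.rpow_inv_le_iff hq, ENNReal.ofReal_rpow_of_pos hM] at h
  exact h

theorem measure_le_norm_sub_le (hq : 0 < q) (hM : 0 < M)
    (h : momentNorm q e μ ≤ ENNReal.ofReal M) {r : ℝ} (hr : 0 < r) :
    μ {x | r ≤ ‖x - e‖} ≤ ENNReal.ofReal ((M / r) ^ q) := by
  have hrq : 0 < r ^ q := Real.rpow_pos_of_pos hr q
  have h1 : {x | r ≤ ‖x - e‖} = {x | ENNReal.ofReal (r ^ q) ≤ edist e x ^ q} := by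
    ext x
    rw [Set.mem_ofPred_eq, Set.mem_ofPred_eq, edist_comm, edist_dist, dist_eq_norm,
      ENNReal.ofReal_rpow_of_nonneg (norm_nonneg _) hq.le,
      ENNReal.ofReal_le_ofReal_iff (by positivity), Real.rpow_le_rpow_iff hr.le (norm_nonneg _) hq]
  have h2 := mul_meas_ge_le_lintegral₀ (μ := μ) (f := fun x => edist e x ^ q)
    (by fun_prop) (ENNReal.ofReal (r ^ q))
  rw [h1, Real.div_rpow hM.le hr.le, ENNReal.ofReal_div_of_pos hrq,
    ENNReal.le_div_iff_mul_le (Or.inl (by simpa using hrq)) (Or.inl ENNReal.ofReal_ne_top), mul_comm]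
  exact h2.trans (lintegral_edist_rpow_le hq hM h)

/-- Markov's inequality at radius `M 2^k / 2`. The factor `2^q` pays for the halved radius, and
being at least 1 it also covers the central ball. -/
theorem measureReal_shell_le [IsProbabilityMeasure μ] (hq : 0 < q) (hM : 0 < M)
    (h : momentNorm q e μ ≤ ENNReal.ofReal M) (k : ℕ) :
    μ.real (shell e M ⁻¹' {k}) ≤ 2 ^ q * ((2 : ℝ) ^ (-q)) ^ k := by
  rcases Nat.eq_zero_or_pos k with rfl | hk
  · rw [pow_zero, mul_one]
    exact measureReal_le_one.trans (Real.one_le_rpow one_le_two hq.le)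
  · have hr : 0 < M * 2 ^ k / 2 := by positivity
    have h1 := measure_le_norm_sub_le hq hM h hr
    have h2 : μ (shell e M ⁻¹' {k}) ≤ ENNReal.ofReal ((M / (M * 2 ^ k / 2)) ^ q) := by
      refine (measure_mono fun x hx => ?_).trans h1
      have hx' : shell e M x = k := hx
      have := shell_lt_norm_sub e hM (x := x) (by omega)
      rw [hx'] at this
      change M * 2 ^ k / 2 ≤ ‖x - e‖
      linarith
    have h3 := ENNReal.toReal_mono ENNReal.ofReal_ne_top h2
    rw [ENNReal.toReal_ofReal (by positivity)] at h3
    refine h3.trans (le_of_eq ?_)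
    rw [show M / (M * 2 ^ k / 2) = 2 * ((2 : ℝ) ^ k)⁻¹ by field_simp,
      Real.mul_rpow two_pos.le (by positivity), Real.inv_rpow (by positivity),
      ← Real.rpow_natCast, ← Real.rpow_natCast, ← Real.rpow_mul two_pos.le,
      ← Real.rpow_mul two_pos.le, neg_mul, Real.rpow_neg two_pos.le, mul_comm q]

end Moment

/-! ### Expectation of the multiscale sum -/

section Expectation

theorem cellWeight_eq (p : ℝ) (k j : ℕ) :
    cellWeight p k j = ((2 : ℝ) ^ p) ^ k * ((2 : ℝ) ^ (-p)) ^ j := by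
  rw [cellWeight, Real.div_rpow (by positivity) (by positivity), ← Real.rpow_natCast,
    ← Real.rpow_natCast, ← Real.rpow_natCast, ← Real.rpow_natCast, ← Real.rpow_mul two_pos.le,
    ← Real.rpow_mul two_pos.le, ← Real.rpow_mul two_pos.le, ← Real.rpow_mul two_pos.le, neg_mul,
    Real.rpow_neg two_pos.le, div_eq_mul_inv, mul_comm p, mul_comm p]

/-- This is Hölder's inequality, obtained from the power mean inequality with exponent `1 / a`
applied to `f i ^ a`. -/
theorem sum_rpow_le_card_rpow_mul {ι : Type*} (s : Finset ι) (f : ι → ℝ) (hf : ∀ i, 0 ≤ f i) {a : ℝ}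
    (ha : 0 < a) (ha1 : a ≤ 1) :
    ∑ i ∈ s, f i ^ a ≤ (s.card : ℝ) ^ (1 - a) * (∑ i ∈ s, f i) ^ a := by
  have h1 := Real.rpow_sum_le_const_mul_sum_rpow s (fun i => f i ^ a)
    (p := 1 / a) ((one_le_div ha).2 ha1)
  have e1 : ∀ i, |f i ^ a| = f i ^ a := fun i => abs_of_nonneg (Real.rpow_nonneg (hf i) a)
  have e2 : ∀ i, (f i ^ a) ^ (1 / a) = f i := fun i => by
    rw [← Real.rpow_mul (hf i), mul_one_div_cancel ha.ne', Real.rpow_one]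
  simp only [e1, e2] at h1
  have h0 : 0 ≤ ∑ i ∈ s, f i ^ a := Finset.sum_nonneg fun i _ => Real.rpow_nonneg (hf i) a
  have h2 : 0 ≤ ∑ i ∈ s, f i := Finset.sum_nonneg fun i _ => hf i
  have h3 := Real.rpow_le_rpow (by positivity) h1 ha.le
  rw [← Real.rpow_mul h0, one_div_mul_cancel ha.ne', Real.rpow_one,
    Real.mul_rpow (by positivity) h2, ← Real.rpow_mul (by positivity)] at h3
  convert h3 using 3
  field_simp

variable {E : Type*} [NormedAddCommGroup E] [NormedSpace ℝ E] [FiniteDimensional ℝ E]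
  [MeasurableSpace E] [BorelSpace E] {d : ℕ} {L : E →ₗ[ℝ] (Fin d → ℝ)} {e : E} {M : ℝ}

theorem measurableSet_cell (L : E →ₗ[ℝ] (Fin d → ℝ)) (e : E) (M : ℝ) (j : ℕ)
    (Q : ℕ × (Fin d → ℤ)) : MeasurableSet (cell L e M j ⁻¹' {Q}) :=
  measurable_cell L e M j (measurableSet_singleton Q)

theorem cell_preimage_eq_empty (hL : ∀ x i, |L x i| ≤ ‖x‖) (hM : 0 < M) (j k : ℕ)
    {v : Fin d → ℤ} (hv : v ∉ cellPositions d j) : cell L e M j ⁻¹' {(k, v)} = ∅ := by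
  ext x
  simp only [Set.mem_preimage, Set.mem_singleton_iff, Set.mem_empty_iff_false, iff_false]
  intro h
  apply hv
  have := cell_snd_mem hL e hM j x
  rwa [h] at this

theorem tsum_cells_eq (hL : ∀ x i, |L x i| ≤ ‖x‖) (hM : 0 < M) (j : ℕ)
    (f : ℕ → ℝ≥0∞) (α β : Measure E) :
    ∑' Q : ℕ × (Fin d → ℤ), f Q.1 *
        absDiff (α (cell L e M j ⁻¹' {Q})) (β (cell L e M j ⁻¹' {Q})) =
      ∑' k : ℕ, f k * ∑ v ∈ cellPositions d j,
        absDiff (α (cell L e M j ⁻¹' {(k, v)})) (β (cell L e M j ⁻¹' {(k, v)})) := by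
  rw [ENNReal.tsum_prod']
  refine tsum_congr fun k => ?_
  dsimp only
  rw [ENNReal.tsum_mul_left, tsum_eq_sum]
  intro v hv
  rw [cell_preimage_eq_empty hL hM j k hv, measure_empty, measure_empty, absDiff_zero]

theorem sum_measureReal_cell_le (μ : Measure E) [IsFiniteMeasure μ] (j k : ℕ)
    (s : Finset (Fin d → ℤ)) :
    ∑ v ∈ s, μ.real (cell L e M j ⁻¹' {(k, v)}) ≤ μ.real (shell e M ⁻¹' {k}) := by
  rw [← measureReal_biUnion_finset]
  · refine measureReal_mono (Set.iUnion₂_subset fun v _ x hx => ?_)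
    exact congrArg Prod.fst (show cell L e M j x = (k, v) from hx)
  · intro v _ w _ hvw
    exact Disjoint.preimage _ (by simpa using hvw)
  · exact fun v _ => measurableSet_cell L e M j _

variable {Ω : Type*} [MeasurableSpace Ω] {P : Measure Ω} [IsProbabilityMeasure P]
  {μ : Measure E} [IsProbabilityMeasure μ] {n : ℕ} {x : Fin n → Ω → E}

/-- Interpolate on each cell, then apply Hölder over the at most `2^((j+2)d)` cells of the shell,
whose masses sum to at most that of the shell. -/
theorem IsIIDSample.lintegral_sum_cells_le (hx : IsIIDSample P μ x) (hn : 0 < n) {s : ℝ}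
    (hs : 0 ≤ s) (hs1 : s ≤ 1) (j k : ℕ) :
    ∑ v ∈ cellPositions d j, ∫⁻ ω, absDiff (empiricalMeasure (fun i => x i ω)
        (cell L e M j ⁻¹' {(k, v)})) (μ (cell L e M j ⁻¹' {(k, v)})) ∂P ≤
      ENNReal.ofReal (2 * (n : ℝ) ^ (-(s / 2)) * ((2 : ℝ) ^ ((j + 2) * d)) ^ (s / 2) *
        μ.real (shell e M ⁻¹' {k}) ^ (1 - s / 2)) := by
  calc _ ≤ ∑ v ∈ cellPositions d j, ENNReal.ofReal
          (2 * μ.real (cell L e M j ⁻¹' {(k, v)}) ^ (1 - s / 2) * (n : ℝ) ^ (-(s / 2))) :=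
        Finset.sum_le_sum fun v _ =>
          hx.lintegral_absDiff_le hn (measurableSet_cell L e M j (k, v)) hs hs1
    _ = ENNReal.ofReal (∑ v ∈ cellPositions d j,
          (2 * μ.real (cell L e M j ⁻¹' {(k, v)}) ^ (1 - s / 2) * (n : ℝ) ^ (-(s / 2)))) := by
        rw [ENNReal.ofReal_sum_of_nonneg]
        intro v _
        positivity
    _ ≤ _ := by
        apply ENNReal.ofReal_le_ofReal
        have h1 := sum_rpow_le_card_rpow_mul (cellPositions d j)
          (fun v => μ.real (cell L e M j ⁻¹' {(k, v)})) (fun v => measureReal_nonneg)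
          (a := 1 - s / 2) (by linarith) (by linarith)
        have h2 := sum_measureReal_cell_le (L := L) (e := e) (M := M) μ j k (cellPositions d j)
        have h3 : ((cellPositions d j).card : ℝ) ≤ (2 : ℝ) ^ ((j + 2) * d) := by
          exact_mod_cast card_cellPositions_le d j
        rw [← Finset.sum_mul, ← Finset.mul_sum]
        have h4 : ∑ v ∈ cellPositions d j, μ.real (cell L e M j ⁻¹' {(k, v)}) ^ (1 - s / 2)
            ≤ ((2 : ℝ) ^ ((j + 2) * d)) ^ (s / 2) * μ.real (shell e M ⁻¹' {k}) ^ (1 - s / 2) := by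
          refine h1.trans ?_
          rw [show 1 - (1 - s / 2) = s / 2 by ring]
          have h5 : 0 ≤ ∑ v ∈ cellPositions d j, μ.real (cell L e M j ⁻¹' {(k, v)}) :=
            Finset.sum_nonneg fun v _ => measureReal_nonneg
          gcongr
          linarith
        calc _ ≤ 2 * (((2 : ℝ) ^ ((j + 2) * d)) ^ (s / 2) *
              μ.real (shell e M ⁻¹' {k}) ^ (1 - s / 2)) * (n : ℝ) ^ (-(s / 2)) := by gcongr
          _ = _ := by ring

theorem IsIIDSample.measurable_absDiff_cell (hx : IsIIDSample P μ x) (j : ℕ)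
    (Q : ℕ × (Fin d → ℤ)) : Measurable fun ω => absDiff (empiricalMeasure (fun i => x i ω)
        (cell L e M j ⁻¹' {Q})) (μ (cell L e M j ⁻¹' {Q})) :=
  measurable_absDiff_const (hx.measurable_empiricalMeasure (measurableSet_cell L e M j Q)) _

theorem IsIIDSample.measurable_cellSum (hx : IsIIDSample P μ x) (p : ℝ) (J : ℕ) :
    Measurable fun ω => cellSum L e M p J (empiricalMeasure (fun i => x i ω)) μ := by
  unfold cellSum
  refine Finset.measurable_sum _ fun j _ => Measurable.ennreal_tsum fun Q => ?_
  exact measurable_const.mul (hx.measurable_absDiff_cell j Q)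

theorem ofReal_tsum_geometric_mul {A B : ℝ} {r : ℝ} (hA : 0 ≤ A) (hr : 0 ≤ r) (hr1 : r < 1)
    (hB : A * (1 - r)⁻¹ = B) : ∑' k : ℕ, ENNReal.ofReal (A * r ^ k) = ENNReal.ofReal B := by
  rw [← ENNReal.ofReal_tsum_of_nonneg (fun k => by positivity)
    ((summable_geometric_of_lt_one hr hr1).mul_left A), tsum_mul_left,
    tsum_geometric_of_lt_one hr hr1, hB]

/-- The weight `2^(pk)` against the shell mass to the power `1 - s/2` gives a geometric series in
`k` of ratio `2^(p - q(1-s/2)) < 1`. The weight `2^(-pj)` against the cell count to the power `s/2`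
gives ratio `2^(ds/2 - p)` in `j`. Measuring shells in units of `M` removes `M` from the bound. -/
theorem IsIIDSample.lintegral_cellSum_le (hx : IsIIDSample P μ x) (hn : 0 < n)
    (hL : ∀ x i, |L x i| ≤ ‖x‖) (hM : 0 < M) {p q s : ℝ} (hq : 0 < q)
    (hmom : momentNorm q e μ ≤ ENNReal.ofReal M) (hs : 0 ≤ s) (hs1 : s ≤ 1)
    (hps : p < q * (1 - s / 2)) (J : ℕ) :
    ∫⁻ ω, cellSum L e M p J (empiricalMeasure (fun i => x i ω)) μ ∂P ≤
      ENNReal.ofReal (2 * (n : ℝ) ^ (-(s / 2)) * 2 ^ (d * s) * (2 ^ q) ^ (1 - s / 2) *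
        (1 - (2 : ℝ) ^ (p - q * (1 - s / 2)))⁻¹ *
        ∑ j ∈ Finset.range (J + 1), ((2 : ℝ) ^ (d * s / 2 - p)) ^ j) := by
  have hr1 : (2 : ℝ) ^ (p - q * (1 - s / 2)) < 1 :=
    Real.rpow_lt_one_of_one_lt_of_neg one_lt_two (by linarith)
  have hr0 : 0 ≤ (2 : ℝ) ^ (p - q * (1 - s / 2)) := by positivity
  have hr2 : 0 ≤ (1 - (2 : ℝ) ^ (p - q * (1 - s / 2)))⁻¹ := inv_nonneg.2 (by linarith)
  unfold cellSum
  rw [lintegral_finsetSum _ fun j _ => Measurable.ennreal_tsum fun Q =>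
    (hx.measurable_absDiff_cell j Q).const_mul _, Finset.mul_sum,
    ENNReal.ofReal_sum_of_nonneg fun j _ => by positivity]
  refine Finset.sum_le_sum fun j _ => ?_
  simp_rw [tsum_cells_eq hL hM j (fun k => ENNReal.ofReal (cellWeight p k j))]
  rw [lintegral_tsum fun k => ((Finset.measurable_sum _ fun v _ =>
    hx.measurable_absDiff_cell j (k, v)).const_mul _).aemeasurable]
  rw [← ofReal_tsum_geometric_mul (A := 2 * (n : ℝ) ^ (-(s / 2)) * 2 ^ (d * s) *
    (2 ^ q) ^ (1 - s / 2) * ((2 : ℝ) ^ (d * s / 2 - p)) ^ j) (by positivity) hr0 hr1 (by ring)]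
  refine ENNReal.tsum_le_tsum fun k => ?_
  rw [lintegral_const_mul _ (Finset.measurable_sum _ fun v _ =>
    hx.measurable_absDiff_cell j (k, v)), lintegral_finsetSum _ fun v _ =>
    hx.measurable_absDiff_cell j (k, v)]
  refine (mul_le_mul_right (hx.lintegral_sum_cells_le hn hs hs1 j k) _).trans ?_
  rw [← ENNReal.ofReal_mul (cellWeight_pos p k j).le]
  apply ENNReal.ofReal_le_ofReal
  have h1 : μ.real (shell e M ⁻¹' {k}) ^ (1 - s / 2)
      ≤ (2 ^ q) ^ (1 - s / 2) * ((2 : ℝ) ^ (- (q * (1 - s / 2)))) ^ k := by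
    calc _ ≤ (2 ^ q * ((2 : ℝ) ^ (-q)) ^ k) ^ (1 - s / 2) :=
          Real.rpow_le_rpow measureReal_nonneg (measureReal_shell_le hq hM hmom k) (by linarith)
      _ = _ := by
          rw [Real.mul_rpow (by positivity) (by positivity), ← Real.rpow_natCast _ k,
            ← Real.rpow_natCast _ k, ← Real.rpow_mul (by positivity), ← Real.rpow_mul (by positivity),
            ← Real.rpow_mul (by positivity), ← Real.rpow_mul (by positivity)]
          congr 2
          ring
  have h2 : ((2 : ℝ) ^ ((j + 2) * d)) ^ (s / 2) = ((2 : ℝ) ^ (d * s / 2)) ^ j * 2 ^ (d * s) := by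
    rw [← Real.rpow_natCast, ← Real.rpow_natCast _ j, ← Real.rpow_mul two_pos.le,
      ← Real.rpow_mul two_pos.le, ← Real.rpow_add two_pos]
    push_cast
    congr 1
    ring
  have h3 : (2 : ℝ) ^ (p - q * (1 - s / 2)) = 2 ^ p * 2 ^ (- (q * (1 - s / 2))) := by
    rw [← Real.rpow_add two_pos]; ring_nf
  have h4 : (2 : ℝ) ^ (d * s / 2 - p) = 2 ^ (d * s / 2) * 2 ^ (- p) := by
    rw [← Real.rpow_add two_pos]; ring_nf
  rw [cellWeight_eq, h2, h3, h4, mul_pow, mul_pow]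
  have hA := mul_le_mul_of_nonneg_left h1 (show 0 ≤ ((2 : ℝ) ^ p) ^ k * ((2 : ℝ) ^ (-p)) ^ j *
    (2 * (n : ℝ) ^ (-(s / 2)) * (((2 : ℝ) ^ (d * s / 2)) ^ j * 2 ^ (d * s))) by positivity)
  refine le_trans (le_of_eq ?_) (hA.trans (le_of_eq ?_)) <;> ring

theorem lintegral_cellWeight_le (hM : 0 < M) {p q : ℝ} (hq : 0 < q) (hpq : p < q)
    (hmom : momentNorm q e μ ≤ ENNReal.ofReal M) (J : ℕ) :
    ∫⁻ y, ENNReal.ofReal (cellWeight p (shell e M y) J) ∂μ ≤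
      ENNReal.ofReal (2 ^ q * (1 - (2 : ℝ) ^ (p - q))⁻¹ * ((2 : ℝ) ^ (-p)) ^ J) := by
  have hr1 : (2 : ℝ) ^ (p - q) < 1 :=
    Real.rpow_lt_one_of_one_lt_of_neg one_lt_two (by linarith)
  rw [lintegral_fiber (measurable_shell e M) μ (fun k => ENNReal.ofReal (cellWeight p k J)),
    ← ofReal_tsum_geometric_mul (A := 2 ^ q * ((2 : ℝ) ^ (-p)) ^ J) (by positivity)
    (by positivity) hr1 (by ring)]
  refine ENNReal.tsum_le_tsum fun k => ?_
  rw [← ofReal_measureReal, ← ENNReal.ofReal_mul (cellWeight_pos p k J).le]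
  apply ENNReal.ofReal_le_ofReal
  have h3 : (2 : ℝ) ^ (p - q) = 2 ^ p * 2 ^ (- q) := by
    rw [← Real.rpow_add two_pos]; ring_nf
  rw [cellWeight_eq, h3, mul_pow]
  have hA := mul_le_mul_of_nonneg_left (measureReal_shell_le hq hM hmom k)
    (show 0 ≤ ((2 : ℝ) ^ p) ^ k * ((2 : ℝ) ^ (-p)) ^ J by positivity)
  refine hA.trans (le_of_eq ?_)
  ring

end Expectation

/-! ### Choice of scales and the expectation bound -/

section Rate

/-- The requirements say `2p/d < s < 2(1 - p/q)` and `s ≤ 1`. The window is nonempty because `p <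
d/2` and because `dp/(d-p) < q` is the same as `p/d < 1 - p/q`. -/
theorem exists_interpolation_exponent {d : ℕ} {p q : ℝ} (hp : 1 ≤ p) (hpd : p < (d : ℝ) / 2)
    (hq : (d : ℝ) * p / ((d : ℝ) - p) < q) :
    p < q ∧ ∃ s : ℝ, 0 ≤ s ∧ s ≤ 1 ∧ p < d * s / 2 ∧ p < q * (1 - s / 2) := by
  have hd : (0 : ℝ) < d := by linarith
  have hdp : 0 < (d : ℝ) - p := by linarith
  rw [div_lt_iff₀ hdp] at hq
  have hq0 : 0 < q := by nlinarith
  have hpq : p < q := by nlinarith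
  refine ⟨hpq, ?_⟩
  have h1 : 2 * p / d < min 1 (2 * (1 - p / q)) := by
    rw [lt_min_iff]
    constructor
    · rw [div_lt_one hd]; linarith
    · rw [div_lt_iff₀ hd]
      have : 2 * (1 - p / q) * d = (2 * (q - p) * d) / q := by field_simp
      rw [this, lt_div_iff₀ hq0]
      nlinarith
  obtain ⟨s, hs1, hs2⟩ := exists_between h1
  rw [lt_min_iff] at hs2
  have hs0 : 0 ≤ 2 * p / d := by positivity
  refine ⟨s, by linarith, hs2.1.le, ?_, ?_⟩
  · rw [div_lt_iff₀ hd] at hs1; linarith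
  · have h2 : p / q < 1 - s / 2 := by linarith [hs2.2]
    rw [div_lt_iff₀ hq0] at h2
    linarith

theorem sum_range_pow_le {r : ℝ} (hr : 1 < r) (J : ℕ) :
    ∑ j ∈ Finset.range (J + 1), r ^ j ≤ r / (r - 1) * r ^ J := by
  have h : 0 < r - 1 := by linarith
  rw [geom_sum_eq hr.ne', div_mul_eq_mul_div]
  gcongr
  rw [pow_succ']
  linarith

/-- The constant in the bound for the expected multiscale distance. -/
noncomputable def multiscaleConst (d p q s : ℝ) : ℝ :=
  2 ^ q * (1 - (2 : ℝ) ^ (p - q))⁻¹ * 2 ^ p +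
    2 * 2 ^ (d * s) * (2 ^ q) ^ (1 - s / 2) * (1 - (2 : ℝ) ^ (p - q * (1 - s / 2)))⁻¹ *
      ((2 : ℝ) ^ (d * s / 2 - p) / ((2 : ℝ) ^ (d * s / 2 - p) - 1))

theorem multiscaleConst_pos {d p q s : ℝ} (hpq : p < q) (hps : p < d * s / 2)
    (hqs : p < q * (1 - s / 2)) : 0 < multiscaleConst d p q s := by
  have hr1 : (2 : ℝ) ^ (p - q * (1 - s / 2)) < 1 :=
    Real.rpow_lt_one_of_one_lt_of_neg one_lt_two (by linarith)
  have hr2 : (2 : ℝ) ^ (p - q) < 1 :=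
    Real.rpow_lt_one_of_one_lt_of_neg one_lt_two (by linarith)
  have hr3 : 1 < (2 : ℝ) ^ (d * s / 2 - p) := Real.one_lt_rpow one_lt_two (by linarith)
  have hr1' : 0 < (1 - (2 : ℝ) ^ (p - q * (1 - s / 2)))⁻¹ := inv_pos.2 (by linarith)
  have hr2' : 0 < (1 - (2 : ℝ) ^ (p - q))⁻¹ := inv_pos.2 (by linarith)
  have hr3' : 0 < (2 : ℝ) ^ (d * s / 2 - p) - 1 := by linarith
  unfold multiscaleConst
  positivity

/-- The multiscale distance between a sample of size `n` and its law is of order `n ^ (-p / d)` when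
the number of scales is adapted to `n`. -/
theorem IsIIDSample.exists_multiscale_le {d : ℕ} {p q s : ℝ} (hp : 1 ≤ p) (hd : (0 : ℝ) < d)
    (hpq : p < q) (hs : 0 ≤ s) (hs1 : s ≤ 1) (hps : p < d * s / 2) (hqs : p < q * (1 - s / 2))
    {E : Type*} [NormedAddCommGroup E] [NormedSpace ℝ E] [FiniteDimensional ℝ E]
    [MeasurableSpace E] [BorelSpace E] {Ω : Type*} [MeasurableSpace Ω] {P : Measure Ω}
    [IsProbabilityMeasure P] {μ : Measure E} [IsProbabilityMeasure μ] {n : ℕ} {x : Fin n → Ω → E}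
    (hx : IsIIDSample P μ x) (hn : 0 < n) {L : E →ₗ[ℝ] (Fin d → ℝ)} (hL : ∀ x i, |L x i| ≤ ‖x‖)
    (e : E) :
    ∃ J : ℕ, ∀ M : ℝ, 0 < M → momentNorm q e μ ≤ ENNReal.ofReal M →
        ∫⁻ y, ENNReal.ofReal (cellWeight p (shell e M y) J) ∂μ
          ≤ ENNReal.ofReal (multiscaleConst d p q s * (n : ℝ) ^ (-(p / d))) ∧
        ∫⁻ ω, cellSum L e M p J (empiricalMeasure (fun i => x i ω)) μ ∂P
          ≤ ENNReal.ofReal (multiscaleConst d p q s * (n : ℝ) ^ (-(p / d))) := by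
  have hq0 : 0 < q := by linarith
  have hr1 : (2 : ℝ) ^ (p - q * (1 - s / 2)) < 1 :=
    Real.rpow_lt_one_of_one_lt_of_neg one_lt_two (by linarith)
  have hr2 : (2 : ℝ) ^ (p - q) < 1 :=
    Real.rpow_lt_one_of_one_lt_of_neg one_lt_two (by linarith)
  have hr3 : 1 < (2 : ℝ) ^ (d * s / 2 - p) := Real.one_lt_rpow one_lt_two (by linarith)
  have hr1' : 0 < (1 - (2 : ℝ) ^ (p - q * (1 - s / 2)))⁻¹ := inv_pos.2 (by linarith)
  have hr2' : 0 < (1 - (2 : ℝ) ^ (p - q))⁻¹ := inv_pos.2 (by linarith)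
  unfold multiscaleConst
  set ρ := (2 : ℝ) ^ (d * s / 2 - p) with hρ
  have hr3' : 0 < ρ / (ρ - 1) := div_pos (by linarith) (by linarith)
  set A := 2 ^ q * (1 - (2 : ℝ) ^ (p - q))⁻¹ * 2 ^ p with hA
  set B := 2 * 2 ^ (d * s) * (2 ^ q) ^ (1 - s / 2) * (1 - (2 : ℝ) ^ (p - q * (1 - s / 2)))⁻¹ *
    (ρ / (ρ - 1)) with hB
  have hA0 : 0 < A := by positivity
  have hB0 : 0 < B := by positivity
  have hn' : (1 : ℝ) ≤ n := by exact_mod_cast hn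
  have hn0 : (0 : ℝ) < n := by linarith
  -- `2^J ≤ n^(1/d) < 2^(J+1)`: the upper inequality controls the discretisation error, the lower
  -- one the last generation of the sum. `J` depends on `n` and `d` only, so it serves every `M`.
  obtain ⟨J, hJ1, hJ2⟩ := exists_nat_pow_near (x := (n : ℝ) ^ (1 / (d : ℝ))) (y := 2)
    (Real.one_le_rpow hn' (by positivity)) one_lt_two
  refine ⟨J, fun M hM hmom => ?_⟩
  constructor
  · refine (lintegral_cellWeight_le hM hq0 hpq hmom J).trans (ENNReal.ofReal_le_ofReal ?_)
    have h1 : ((2 : ℝ) ^ (-p)) ^ J ≤ 2 ^ p * (n : ℝ) ^ (-(p / d)) := by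
      have h2 : ((n : ℝ) ^ (1 / (d : ℝ))) ^ p ≤ ((2 : ℝ) ^ (J + 1)) ^ p := by gcongr
      rw [← Real.rpow_mul hn0.le, one_div_mul_eq_div] at h2
      have h3 : ((2 : ℝ) ^ (J + 1)) ^ p * ((2 : ℝ) ^ (-p)) ^ J = 2 ^ p := by
        rw [← Real.rpow_natCast, ← Real.rpow_natCast _ J, ← Real.rpow_mul two_pos.le,
          ← Real.rpow_mul two_pos.le, ← Real.rpow_add two_pos]
        congr 1
        push_cast
        ring
      rw [Real.rpow_neg hn0.le, ← div_eq_mul_inv, le_div_iff₀ (by positivity), mul_comm, ← h3]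
      gcongr
    calc _ ≤ 2 ^ q * (1 - (2 : ℝ) ^ (p - q))⁻¹ * (2 ^ p * (n : ℝ) ^ (-(p / d))) := by gcongr
      _ = A * (n : ℝ) ^ (-(p / d)) := by rw [hA]; ring
      _ ≤ _ := by gcongr; linarith
  · refine (hx.lintegral_cellSum_le hn hL hM hq0 hmom hs hs1 hqs J).trans
      (ENNReal.ofReal_le_ofReal ?_)
    have h1 := sum_range_pow_le hr3 J
    have h2 : ρ ^ J * (n : ℝ) ^ (-(s / 2)) ≤ (n : ℝ) ^ (-(p / d)) := by
      have h3 : ρ ^ J ≤ (n : ℝ) ^ (s / 2 - p / d) := by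
        calc ρ ^ J = ((2 : ℝ) ^ J) ^ (d * s / 2 - p) := by
              rw [hρ, ← Real.rpow_natCast, ← Real.rpow_natCast, ← Real.rpow_mul two_pos.le,
                ← Real.rpow_mul two_pos.le, mul_comm]
          _ ≤ ((n : ℝ) ^ (1 / (d : ℝ))) ^ (d * s / 2 - p) := by
              apply Real.rpow_le_rpow (by positivity) hJ1 (by linarith)
          _ = _ := by
              rw [← Real.rpow_mul hn0.le]
              congr 1
              field_simp
      calc _ ≤ (n : ℝ) ^ (s / 2 - p / d) * (n : ℝ) ^ (-(s / 2)) := by gcongr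
        _ = _ := by rw [← Real.rpow_add hn0]; congr 1; ring
    calc _ ≤ 2 * (n : ℝ) ^ (-(s / 2)) * 2 ^ (d * s) * (2 ^ q) ^ (1 - s / 2) *
          (1 - (2 : ℝ) ^ (p - q * (1 - s / 2)))⁻¹ * (ρ / (ρ - 1) * ρ ^ J) := by gcongr
      _ = B * (ρ ^ J * (n : ℝ) ^ (-(s / 2))) := by rw [hB]; ring
      _ ≤ B * (n : ℝ) ^ (-(p / d)) := by gcongr
      _ ≤ _ := by gcongr; linarith

/-- The expectation bound for the Wasserstein distance, with moments about an arbitrary point. -/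
theorem rpow_lintegral_wasserstein_le {d : ℕ} {p q C κ : ℝ} (hp : 1 ≤ p) (hd : 1 ≤ d) (hκ : 0 < κ)
    (hC : (2 * d) ^ p * (2 * C) ≤ κ ^ p) {E : Type*} [NormedAddCommGroup E] [NormedSpace ℝ E]
    [FiniteDimensional ℝ E] [MeasurableSpace E] [BorelSpace E] {Ω : Type*} [MeasurableSpace Ω]
    {P : Measure Ω} {μ : Measure E} [IsProbabilityMeasure μ] {n : ℕ}
    {x : Fin n → Ω → E} (hn : 0 < n) {L : E →ₗ[ℝ] (Fin d → ℝ)}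
    (hL : ∀ x, ‖x‖ ≤ d * ‖L x‖) {e : E} {J : ℕ} (hC0 : 0 < C)
    (h : ∀ M : ℝ, 0 < M → momentNorm q e μ ≤ ENNReal.ofReal M →
        ∫⁻ y, ENNReal.ofReal (cellWeight p (shell e M y) J) ∂μ
          ≤ ENNReal.ofReal (C * (n : ℝ) ^ (-(p / d))) ∧
        ∫⁻ ω, cellSum L e M p J (empiricalMeasure (fun i => x i ω)) μ ∂P
          ≤ ENNReal.ofReal (C * (n : ℝ) ^ (-(p / d)))) [IsProbabilityMeasure P] :
    (∫⁻ ω, wasserstein p (empiricalMeasure fun i => x i ω) μ ^ p ∂P) ^ (1 / p)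
      ≤ ENNReal.ofReal κ * momentNorm q e μ * ENNReal.ofReal ((n : ℝ) ^ (-(1 / (d : ℝ)))) := by
  have hp0 : 0 < p := by linarith
  have hn0 : (0 : ℝ) < n := by exact_mod_cast hn
  have hnd : 0 < (n : ℝ) ^ (-(1 / (d : ℝ))) := by positivity
  have key : ∀ M : ℝ, 0 < M → momentNorm q e μ ≤ ENNReal.ofReal M →
      (∫⁻ ω, wasserstein p (empiricalMeasure fun i => x i ω) μ ^ p ∂P) ^ (1 / p)
        ≤ ENNReal.ofReal κ * ENNReal.ofReal M * ENNReal.ofReal ((n : ℝ) ^ (-(1 / (d : ℝ)))) := by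
    intro M hM hmom
    obtain ⟨h1, h2⟩ := h M hM hmom
    rw [one_div, ENNReal.rpow_inv_le_iff hp0, ← ENNReal.ofReal_mul hκ.le,
      ← ENNReal.ofReal_mul (by positivity), ENNReal.ofReal_rpow_of_pos (by positivity)]
    calc ∫⁻ ω, wasserstein p (empiricalMeasure fun i => x i ω) μ ^ p ∂P
        ≤ ∫⁻ ω, ENNReal.ofReal ((2 * d * M) ^ p) *
          (∫⁻ y, ENNReal.ofReal (cellWeight p (shell e M y) J) ∂μ +
            cellSum L e M p J (empiricalMeasure fun i => x i ω) μ) ∂P := by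
          refine lintegral_mono fun ω => ?_
          have := isProbabilityMeasure_empiricalMeasure hn fun i => x i ω
          exact wasserstein_rpow_le_cellSum hL hd e hM hp0 J _ _
      _ = ENNReal.ofReal ((2 * d * M) ^ p) *
          (∫⁻ y, ENNReal.ofReal (cellWeight p (shell e M y) J) ∂μ +
            ∫⁻ ω, cellSum L e M p J (empiricalMeasure fun i => x i ω) μ ∂P) := by
          rw [lintegral_const_mul' _ _ ENNReal.ofReal_ne_top, lintegral_add_left measurable_const]
          simp
      _ ≤ ENNReal.ofReal ((2 * d * M) ^ p) * (ENNReal.ofReal (C * (n : ℝ) ^ (-(p / d))) +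
            ENNReal.ofReal (C * (n : ℝ) ^ (-(p / d)))) := by gcongr
      _ = ENNReal.ofReal ((2 * d) ^ p * (2 * C) * M ^ p * (n : ℝ) ^ (-(p / d))) := by
          rw [← ENNReal.ofReal_add (by positivity) (by positivity),
            ← ENNReal.ofReal_mul (by positivity), Real.mul_rpow (by positivity) hM.le]
          congr 1
          ring
      _ ≤ ENNReal.ofReal ((κ * M * (n : ℝ) ^ (-(1 / (d : ℝ)))) ^ p) := by
          apply ENNReal.ofReal_le_ofReal
          rw [Real.mul_rpow (by positivity) hnd.le, Real.mul_rpow hκ.le hM.le,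
            ← Real.rpow_mul hn0.le, show -(1 / (d : ℝ)) * p = -(p / d) by ring]
          gcongr
  -- The scale `M` must be positive and finite. An infinite moment makes the bound trivial;
  -- otherwise `M` decreases to the moment, which may be 0 for a Dirac mass.
  rcases eq_or_ne (momentNorm q e μ) ∞ with htop | htop
  · rw [htop, ENNReal.mul_top (by simpa using hκ), ENNReal.top_mul (by simpa using hnd)]
    exact le_top
  · set m := (momentNorm q e μ).toReal with hm
    have hm' : momentNorm q e μ = ENNReal.ofReal m := (ENNReal.ofReal_toReal htop).symm
    have hm0 : 0 ≤ m := ENNReal.toReal_nonneg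
    rw [hm', ← ENNReal.ofReal_mul hκ.le, ← ENNReal.ofReal_mul (by positivity)]
    have hlim : Filter.Tendsto (fun M : ℝ => ENNReal.ofReal (κ * M * (n : ℝ) ^ (-(1 / (d : ℝ)))))
        (nhdsWithin m (Set.Ioi m)) (nhds (ENNReal.ofReal (κ * m * (n : ℝ) ^ (-(1 / (d : ℝ)))))) := by
      refine Filter.Tendsto.mono_left ?_ nhdsWithin_le_nhds
      have : Continuous fun M : ℝ => ENNReal.ofReal (κ * M * (n : ℝ) ^ (-(1 / (d : ℝ)))) :=
        ENNReal.continuous_ofReal.comp ((continuous_const.mul continuous_id).mul continuous_const)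
      exact this.tendsto m
    refine ge_of_tendsto hlim ?_
    filter_upwards [self_mem_nhdsWithin] with M hM
    have hM' : m < M := hM
    have hM0 : 0 < M := by linarith
    have := key M hM0 (by rw [hm']; exact ENNReal.ofReal_le_ofReal hM'.le)
    rwa [← ENNReal.ofReal_mul hκ.le, ← ENNReal.ofReal_mul (by positivity)] at this

end Rate

/-! ### McDiarmid's inequality -/

section BoundedDifferences

variable {X : Type*} [MeasurableSpace X]

theorem integrable_of_bounded {Y : Type*} [MeasurableSpace Y] {μ : Measure Y} [IsFiniteMeasure μ]
    {f : Y → ℝ} (hf : Measurable f) {B : ℝ} (hB : ∀ x, |f x| ≤ B) : Integrable f μ :=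
  Integrable.of_bound hf.aestronglyMeasurable B (Filter.Eventually.of_forall hB)

theorem integral_pi_succ (μ : Measure X) [IsProbabilityMeasure μ] {n : ℕ}
    {F : (Fin (n + 1) → X) → ℝ} (hF : Measurable F) {B : ℝ} (hB : ∀ x, |F x| ≤ B) :
    ∫ x, F x ∂(Measure.pi fun _ => μ) =
      ∫ a, ∫ y, F (Fin.cons a y) ∂(Measure.pi fun _ : Fin n => μ) ∂μ := by
  have h := (measurePreserving_piFinSuccAbove (fun _ : Fin (n + 1) => μ) 0).symm
  have hcons : ∀ z : X × (Fin n → X),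
      (MeasurableEquiv.piFinSuccAbove (fun _ : Fin (n + 1) => X) 0).symm z = Fin.cons z.1 z.2 := by
    intro z
    simp only [MeasurableEquiv.piFinSuccAbove_symm_apply, Fin.insertNthEquiv_zero]
    rfl
  rw [← h.integral_comp' F, integral_prod]
  · simp only [hcons]
  · exact integrable_of_bounded (hF.comp (MeasurableEquiv.measurable _)) fun z => hB _

/-- **McDiarmid's inequality** (with a non-optimal constant): a function of `n` independent
variables which changes by at most `c` when one of them is changed is sub-Gaussian. -/
theorem hasSubgaussianMGF_pi_of_bounded_differences (μ : Measure X) [IsProbabilityMeasure μ]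
    {n : ℕ} {f : (Fin n → X) → ℝ} (hf : Measurable f) {B : ℝ} (hB : ∀ x, |f x| ≤ B) {c : NNReal}
    (hc : ∀ x i y, |f x - f (Function.update x i y)| ≤ c) :
    HasSubgaussianMGF (fun x => f x - ∫ y, f y ∂(Measure.pi fun _ => μ)) (n * c ^ 2)
      (Measure.pi fun _ => μ) := by
  -- Exponentials of bounded functions are bounded, which settles every integrability question
  -- below.
  have hexp : ∀ {Y : Type _} [MeasurableSpace Y] (ν : Measure Y) [IsFiniteMeasure ν] (h : Y → ℝ)
      (_ : Measurable h) (D : ℝ) (_ : ∀ x, |h x| ≤ D) (t m : ℝ),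
      Measurable (fun x => Real.exp (t * (h x - m))) ∧
      ∀ x, |Real.exp (t * (h x - m))| ≤ Real.exp (|t| * (D + |m|)) := by
    intro Y _ ν _ h hh D hD t m
    refine ⟨Real.measurable_exp.comp (measurable_const.mul (hh.sub measurable_const)), fun x => ?_⟩
    rw [Real.abs_exp]
    apply Real.exp_le_exp.2
    calc t * (h x - m) ≤ |t * (h x - m)| := le_abs_self _
      _ = |t| * |h x - m| := abs_mul _ _
      _ ≤ |t| * (D + |m|) := by
          gcongr
          exact (abs_sub _ _).trans (by linarith [hD x])
  induction n generalizing B with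
  | zero =>
    have : ∀ x, f x - ∫ y, f y ∂(Measure.pi fun _ : Fin 0 => μ) = 0 := by
      intro x
      have : ∀ y, f y = f x := fun y => by rw [Subsingleton.elim y x]
      simp [this]
    simp only [this]
    simp
  | succ n ih =>
    set m := ∫ y, f y ∂(Measure.pi fun _ => μ) with hm
    -- `g` averages out all coordinates but the first. Then `f - m = (f - g) + (g - m)`: the first
    -- bracket is sub-Gaussian for fixed first coordinate by induction, and the second by
    -- Hoeffding's lemma.
    set g : X → ℝ := fun a => ∫ y, f (Fin.cons a y) ∂(Measure.pi fun _ : Fin n => μ) with hg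
    have hconsm : Measurable fun z : X × (Fin n → X) => (Fin.cons z.1 z.2 : Fin (n + 1) → X) := by
      refine measurable_pi_lambda _ fun i => ?_
      refine Fin.cases ?_ (fun i => ?_) i
      · exact measurable_fst
      · exact (measurable_pi_apply i).comp measurable_snd
    have hfc : Measurable fun z : X × (Fin n → X) => f (Fin.cons z.1 z.2) := hf.comp hconsm
    have hfca : ∀ a, Measurable fun y : Fin n → X => f (Fin.cons a y) := fun a =>
      hfc.comp measurable_prodMk_left
    have hgm : Measurable g :=
      (hfc.stronglyMeasurable.integral_prod_right (ν := Measure.pi fun _ : Fin n => μ)).measurable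
    have hgB : ∀ a, |g a| ≤ B := fun a => by
      have := norm_integral_le_of_norm_le_const (μ := Measure.pi fun _ : Fin n => μ)
        (f := fun y => f (Fin.cons a y)) (C := B) (Filter.Eventually.of_forall fun y => hB _)
      simpa using this
    have hmg : m = ∫ a, g a ∂μ := integral_pi_succ μ hf hB
    have hgc : ∀ a b, |g a - g b| ≤ c := fun a b => by
      rw [hg]
      simp only
      rw [← integral_sub (integrable_of_bounded (hfca a) fun y => hB _)
        (integrable_of_bounded (hfca b) fun y => hB _)]
      have := norm_integral_le_of_norm_le_const (μ := Measure.pi fun _ : Fin n => μ)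
        (f := fun y => f (Fin.cons a y) - f (Fin.cons b y)) (C := c)
        (Filter.Eventually.of_forall fun y => by
          have := hc (Fin.cons a y) 0 b
          rwa [Fin.update_cons_zero] at this)
      simpa using this
    have hgm' : ∀ a, |g a - m| ≤ c := fun a => by
      have h1 : g a - m = ∫ b, (g a - g b) ∂μ := by
        rw [integral_sub (integrable_const _) (integrable_of_bounded hgm hgB), ← hmg]
        simp
      rw [h1]
      have := norm_integral_le_of_norm_le_const (μ := μ) (f := fun b => g a - g b) (C := c)
        (Filter.Eventually.of_forall fun b => hgc a b)
      simpa using this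
    -- Hoeffding's lemma is applied on `[-c, c]`, of length `2c`, giving parameter `c^2`; the actual
    -- range of `g` has length at most `c`, so a factor 4 is given away here.
    have hsub : HasSubgaussianMGF (fun a => g a - m) (c ^ 2) μ := by
      have := hasSubgaussianMGF_of_mem_Icc_of_integral_eq_zero (μ := μ) (X := fun a => g a - m)
        (a := -c) (b := c) (hgm.sub measurable_const).aemeasurable
        (Filter.Eventually.of_forall fun a => abs_le.1 (hgm' a)) (by
          rw [integral_sub (integrable_of_bounded hgm hgB) (integrable_const _), ← hmg]
          simp)
      convert this using 1
      have : ‖(c : ℝ) - -c‖₊ = 2 * c := by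
        rw [← NNReal.coe_inj]
        simp only [coe_nnnorm, sub_neg_eq_add, Real.norm_eq_abs, NNReal.coe_mul, NNReal.coe_ofNat]
        rw [abs_of_nonneg (by positivity)]
        ring
      rw [this]
      field_simp
    have hsub' : ∀ a, HasSubgaussianMGF (fun y => f (Fin.cons a y) - g a) (n * c ^ 2)
        (Measure.pi fun _ : Fin n => μ) := fun a =>
      ih (hfca a) (fun y => hB _) fun y i z => by
        have := hc (Fin.cons a y) i.succ z
        rwa [← Fin.cons_update] at this
    refine ⟨fun t => ?_, fun t => ?_⟩
    · obtain ⟨h1, h2⟩ := hexp (Measure.pi fun _ : Fin (n + 1) => μ) f hf B hB t m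
      exact integrable_of_bounded h1 h2
    · obtain ⟨h1, h2⟩ := hexp (Measure.pi fun _ : Fin (n + 1) => μ) f hf B hB t m
      rw [mgf, integral_pi_succ μ h1 h2]
      have h3 : ∀ a, ∫ y, Real.exp (t * (f (Fin.cons a y) - m)) ∂(Measure.pi fun _ : Fin n => μ)
          ≤ Real.exp (t * (g a - m)) * Real.exp (n * c ^ 2 * t ^ 2 / 2) := by
        intro a
        have h4 := (hsub' a).mgf_le t
        rw [mgf] at h4
        push_cast at h4
        calc _ = Real.exp (t * (g a - m)) *
              ∫ y, Real.exp (t * (f (Fin.cons a y) - g a)) ∂(Measure.pi fun _ : Fin n => μ) := by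
              rw [← integral_const_mul]
              refine integral_congr_ae (Filter.Eventually.of_forall fun y => ?_)
              simp only
              rw [← Real.exp_add]
              congr 1
              ring
          _ ≤ _ := by gcongr
      have h5 := hsub.mgf_le t
      rw [mgf] at h5
      push_cast at h5
      have h6 := hexp μ g hgm B hgB t m
      calc _ ≤ ∫ a, Real.exp (t * (g a - m)) * Real.exp (n * c ^ 2 * t ^ 2 / 2) ∂μ := by
            refine integral_mono_of_nonneg (Filter.Eventually.of_forall fun a =>
              integral_nonneg fun y => (Real.exp_pos _).le)
              ((integrable_of_bounded h6.1 h6.2).mul_const _) (Filter.Eventually.of_forall h3)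
        _ = (∫ a, Real.exp (t * (g a - m)) ∂μ) * Real.exp (n * c ^ 2 * t ^ 2 / 2) :=
            integral_mul_const _ _
        _ ≤ Real.exp (c ^ 2 * t ^ 2 / 2) * Real.exp (n * c ^ 2 * t ^ 2 / 2) := by gcongr
        _ = _ := by
            rw [← Real.exp_add]
            congr 1
            push_cast
            ring

/-- The upper tail in McDiarmid's inequality. -/
theorem measureReal_pi_ge_le_of_bounded_differences (μ : Measure X) [IsProbabilityMeasure μ]
    {n : ℕ} {f : (Fin n → X) → ℝ} (hf : Measurable f) {B : ℝ} (hB : ∀ x, |f x| ≤ B) {c : ℝ}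
    (hc0 : 0 ≤ c) (hc : ∀ x i y, |f x - f (Function.update x i y)| ≤ c) {t : ℝ} (ht : 0 ≤ t) :
    (Measure.pi fun _ : Fin n => μ).real {x | ∫ y, f y ∂(Measure.pi fun _ => μ) + t ≤ f x} ≤
      Real.exp (-(t ^ 2 / (2 * n * c ^ 2))) := by
  have h := (hasSubgaussianMGF_pi_of_bounded_differences μ hf hB (c := ⟨c, hc0⟩) hc).measure_ge_le ht
  have e : {x | ∫ y, f y ∂(Measure.pi fun _ => μ) + t ≤ f x} =
      {x | t ≤ f x - ∫ y, f y ∂(Measure.pi fun _ => μ)} := by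
    ext x
    rw [Set.mem_ofPred_eq, Set.mem_ofPred_eq, le_sub_iff_add_le, add_comm]
  rw [e]
  refine h.trans (le_of_eq ?_)
  congr 1
  push_cast
  rw [neg_div, ← mul_assoc]
  rfl

end BoundedDifferences

/-! ### Bounded differences for the inner shells -/

section InnerSum

variable {E : Type*} [NormedAddCommGroup E] [NormedSpace ℝ E] [FiniteDimensional ℝ E]
  [MeasurableSpace E] [BorelSpace E] {d : ℕ} {L : E →ₗ[ℝ] (Fin d → ℝ)} {e : E} {M : ℝ}

/-- The cells of generation `j` in the shells `0, …, K`. -/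
noncomputable def innerCells (d K j : ℕ) : Finset (ℕ × (Fin d → ℤ)) :=
  Finset.range (K + 1) ×ˢ cellPositions d j

/-- The part of the multiscale distance between the empirical measure of `y` and `μ` coming from the
shells `0, …, K`. -/
noncomputable def innerSum (L : E →ₗ[ℝ] (Fin d → ℝ)) (e : E) (M p : ℝ) (J K : ℕ) (μ : Measure E)
    {n : ℕ} (y : Fin n → E) : ℝ :=
  ∑ j ∈ Finset.range (J + 1), ∑ Q ∈ innerCells d K j, cellWeight p Q.1 j *
    |(∑ i, (cell L e M j ⁻¹' {Q}).indicator (1 : E → ℝ) (y i)) / n - μ.real (cell L e M j ⁻¹' {Q})|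

theorem measurable_innerSum (L : E →ₗ[ℝ] (Fin d → ℝ)) (e : E) (M p : ℝ) (J K : ℕ) (μ : Measure E)
    (n : ℕ) : Measurable fun y : Fin n → E => innerSum L e M p J K μ y := by
  unfold innerSum
  refine Finset.measurable_sum _ fun j _ => Finset.measurable_sum _ fun Q _ => ?_
  refine measurable_const.mul (Measurable.abs ?_)
  refine ((Finset.measurable_sum _ fun i _ => ?_).div_const _).sub measurable_const
  exact (measurable_one.indicator (measurableSet_cell L e M j Q)).comp (measurable_pi_apply i)

theorem innerSum_nonneg (L : E →ₗ[ℝ] (Fin d → ℝ)) (e : E) (M p : ℝ) (J K : ℕ) (μ : Measure E)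
    {n : ℕ} (y : Fin n → E) : 0 ≤ innerSum L e M p J K μ y :=
  Finset.sum_nonneg fun j _ => Finset.sum_nonneg fun Q _ =>
    mul_nonneg (cellWeight_pos p Q.1 j).le (abs_nonneg _)

theorem abs_innerSum_le (L : E →ₗ[ℝ] (Fin d → ℝ)) (e : E) (M p : ℝ) (J K : ℕ) (μ : Measure E)
    [IsProbabilityMeasure μ] {n : ℕ} (hn : 0 < n) (y : Fin n → E) :
    |innerSum L e M p J K μ y| ≤
      ∑ j ∈ Finset.range (J + 1), ∑ Q ∈ innerCells d K j, cellWeight p Q.1 j * 1 := by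
  rw [abs_of_nonneg (innerSum_nonneg L e M p J K μ y)]
  refine Finset.sum_le_sum fun j _ => Finset.sum_le_sum fun Q _ => ?_
  refine mul_le_mul_of_nonneg_left ?_ (cellWeight_pos p Q.1 j).le
  have := isProbabilityMeasure_empiricalMeasure hn y
  rw [← empiricalMeasure_real y (measurableSet_cell L e M j Q)]
  have h1 : ((empiricalMeasure y) (cell L e M j ⁻¹' {Q})).toReal ≤ 1 :=
    measureReal_le_one (μ := empiricalMeasure y)
  have h2 : 0 ≤ ((empiricalMeasure y) (cell L e M j ⁻¹' {Q})).toReal := ENNReal.toReal_nonneg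
  have h3 : μ.real (cell L e M j ⁻¹' {Q}) ≤ 1 := measureReal_le_one
  have h4 : 0 ≤ μ.real (cell L e M j ⁻¹' {Q}) := measureReal_nonneg
  rw [abs_le]
  constructor <;> linarith

theorem cellWeight_mono {p : ℝ} (hp : 0 ≤ p) {k K : ℕ} (h : k ≤ K) (j : ℕ) :
    cellWeight p k j ≤ cellWeight p K j := by
  unfold cellWeight
  gcongr
  norm_num

theorem sum_cellWeight_le {p : ℝ} (hp : 1 ≤ p) (k J : ℕ) :
    ∑ j ∈ Finset.range (J + 1), cellWeight p k j ≤ 2 * ((2 : ℝ) ^ p) ^ k := by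
  simp_rw [cellWeight_eq]
  rw [← Finset.mul_sum, mul_comm]
  gcongr
  have h1 : (2 : ℝ) ^ (-p) ≤ 2⁻¹ := by
    rw [← Real.rpow_neg_one]
    exact Real.rpow_le_rpow_of_exponent_le one_le_two (by linarith)
  calc ∑ j ∈ Finset.range (J + 1), ((2 : ℝ) ^ (-p)) ^ j
      ≤ ∑ j ∈ Finset.range (J + 1), ((2 : ℝ)⁻¹) ^ j := by gcongr
    _ ≤ ∑' j, ((2 : ℝ)⁻¹) ^ j :=
        (summable_geometric_of_lt_one (by norm_num) (by norm_num)).sum_le_tsum _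
          fun j _ => by positivity
    _ = 2 := by rw [tsum_geometric_of_lt_one (by norm_num) (by norm_num)]; norm_num

/-- Each point lies in exactly one cell of a given generation, so at most one summand survives. -/
theorem sum_innerCells_indicator_le (L : E →ₗ[ℝ] (Fin d → ℝ)) (e : E) (M : ℝ) {p : ℝ} (hp : 0 ≤ p)
    (K j : ℕ) (z : E) :
    ∑ Q ∈ innerCells d K j, cellWeight p Q.1 j * (cell L e M j ⁻¹' {Q}).indicator (1 : E → ℝ) z
      ≤ cellWeight p K j := by
  classical
  have h1 : ∀ Q : ℕ × (Fin d → ℤ), cellWeight p Q.1 j *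
      (cell L e M j ⁻¹' {Q}).indicator (1 : E → ℝ) z =
      if cell L e M j z = Q then cellWeight p Q.1 j else 0 := by
    intro Q
    by_cases h : cell L e M j z = Q <;> simp [Set.indicator, h]
  simp_rw [h1]
  rw [Finset.sum_ite_eq]
  split_ifs with h
  · rw [innerCells, Finset.mem_product, Finset.mem_range] at h
    exact cellWeight_mono hp (by omega) j
  · exact (cellWeight_pos p K j).le

/-- Moving one point changes the masses of at most two cells per generation by `1/n` each, and the
weights over all generations sum to at most `2 · 2^(pK)`; hence the 4. The cutoff `K` is what makes
the influence bounded. -/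
theorem abs_innerSum_sub_update_le (L : E →ₗ[ℝ] (Fin d → ℝ)) (e : E) (M : ℝ) {p : ℝ} (hp : 1 ≤ p)
    (J K : ℕ) (μ : Measure E) {n : ℕ} (y : Fin n → E) (i : Fin n) (z : E) :
    |innerSum L e M p J K μ y - innerSum L e M p J K μ (Function.update y i z)| ≤
      4 * ((2 : ℝ) ^ p) ^ K / n := by
  classical
  have hp0 : 0 ≤ p := by linarith
  let dev : ℕ → ℕ × (Fin d → ℤ) → (Fin n → E) → ℝ := fun j Q y =>
    |(∑ i, (cell L e M j ⁻¹' {Q}).indicator (1 : E → ℝ) (y i)) / n - μ.real (cell L e M j ⁻¹' {Q})|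
  have hdev : ∀ y, innerSum L e M p J K μ y =
      ∑ j ∈ Finset.range (J + 1), ∑ Q ∈ innerCells d K j, cellWeight p Q.1 j * dev j Q y :=
    fun y => rfl
  rw [hdev, hdev, ← Finset.sum_sub_distrib]
  refine (Finset.abs_sum_le_sum_abs _ _).trans ?_
  have key : ∀ j, |∑ Q ∈ innerCells d K j, cellWeight p Q.1 j * dev j Q y -
      ∑ Q ∈ innerCells d K j, cellWeight p Q.1 j * dev j Q (Function.update y i z)|
      ≤ cellWeight p K j * (2 / n) := by
    intro j
    rw [← Finset.sum_sub_distrib]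
    refine (Finset.abs_sum_le_sum_abs _ _).trans ?_
    have h1 : ∀ Q : ℕ × (Fin d → ℤ),
        |cellWeight p Q.1 j * dev j Q y - cellWeight p Q.1 j * dev j Q (Function.update y i z)| ≤
        (cellWeight p Q.1 j * (cell L e M j ⁻¹' {Q}).indicator (1 : E → ℝ) (y i) +
        cellWeight p Q.1 j * (cell L e M j ⁻¹' {Q}).indicator (1 : E → ℝ) z) * (1 / n) := by
      intro Q
      rw [← mul_sub, abs_mul, abs_of_pos (cellWeight_pos p Q.1 j), ← mul_add, mul_assoc]
      refine mul_le_mul_of_nonneg_left ?_ (cellWeight_pos p Q.1 j).le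
      refine (abs_abs_sub_abs_le_abs_sub _ _).trans ?_
      rw [sub_sub_sub_cancel_right, ← sub_div, ← Finset.sum_sub_distrib, Finset.sum_eq_single i]
      · rw [Function.update_self, abs_div, Nat.abs_cast, div_eq_mul_one_div]
        gcongr
        have h3 : ∀ a, 0 ≤ (cell L e M j ⁻¹' {Q}).indicator (1 : E → ℝ) a := fun a =>
          Set.indicator_nonneg (fun _ _ => zero_le_one) _
        have h4 := h3 z
        have h5 := h3 (y i)
        rw [abs_le]
        constructor <;> linarith
      · intro i' _ hi'
        rw [Function.update_of_ne hi', sub_self]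
      · simp
    refine (Finset.sum_le_sum fun Q _ => h1 Q).trans ?_
    rw [← Finset.sum_mul, Finset.sum_add_distrib]
    have h6 := sum_innerCells_indicator_le L e M hp0 K j (y i)
    have h7 := sum_innerCells_indicator_le L e M hp0 K j z
    calc _ ≤ (cellWeight p K j + cellWeight p K j) * (1 / n) := by gcongr
      _ = _ := by ring
  refine (Finset.sum_le_sum fun j _ => key j).trans ?_
  rw [← Finset.sum_mul]
  calc _ ≤ (2 * ((2 : ℝ) ^ p) ^ K) * (2 / n) := by
        gcongr; exact sum_cellWeight_le hp K J
    _ = _ := by ring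

theorem ofReal_innerSum (L : E →ₗ[ℝ] (Fin d → ℝ)) (e : E) (M p : ℝ) (J K : ℕ) (μ : Measure E)
    [IsFiniteMeasure μ] {n : ℕ} (hn : 0 < n) (y : Fin n → E) :
    ENNReal.ofReal (innerSum L e M p J K μ y) =
      ∑ j ∈ Finset.range (J + 1), ∑ Q ∈ innerCells d K j, ENNReal.ofReal (cellWeight p Q.1 j) *
        absDiff (empiricalMeasure y (cell L e M j ⁻¹' {Q})) (μ (cell L e M j ⁻¹' {Q})) := by
  have h0 : ∀ j (Q : ℕ × (Fin d → ℤ)), 0 ≤ cellWeight p Q.1 j *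
    |(∑ i, (cell L e M j ⁻¹' {Q}).indicator (1 : E → ℝ) (y i)) / n -
      μ.real (cell L e M j ⁻¹' {Q})| := fun j Q =>
    mul_nonneg (cellWeight_pos p Q.1 j).le (abs_nonneg _)
  unfold innerSum
  rw [ENNReal.ofReal_sum_of_nonneg fun j _ => Finset.sum_nonneg fun Q _ => h0 j Q]
  refine Finset.sum_congr rfl fun j _ => ?_
  rw [ENNReal.ofReal_sum_of_nonneg fun Q _ => h0 j Q]
  refine Finset.sum_congr rfl fun Q _ => ?_
  rw [ENNReal.ofReal_mul (cellWeight_pos p Q.1 j).le,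
    absDiff_eq (empiricalMeasure_ne_top hn _ _) (measure_ne_top _ _),
    empiricalMeasure_real _ (measurableSet_cell L e M j Q)]
  rfl

theorem ofReal_innerSum_le_cellSum (L : E →ₗ[ℝ] (Fin d → ℝ)) (e : E) (M p : ℝ) (J K : ℕ)
    (μ : Measure E) [IsFiniteMeasure μ] {n : ℕ} (hn : 0 < n) (y : Fin n → E) :
    ENNReal.ofReal (innerSum L e M p J K μ y) ≤ cellSum L e M p J (empiricalMeasure y) μ := by
  rw [ofReal_innerSum L e M p J K μ hn y]
  exact Finset.sum_le_sum fun j _ => ENNReal.sum_le_tsum _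

/-- The weight of the cells of generation `j` outside of the shells `0, …, K`. -/
noncomputable def tailWeight (p : ℝ) (K j k : ℕ) : ℝ≥0∞ :=
  if K < k then ENNReal.ofReal (cellWeight p k j) else 0

/-- Beyond shell `K` cancellation is given up, and `|a - b| ≤ a + b` separates the sample from its
law. -/
theorem cellSum_le_innerSum_add (hL : ∀ x i, |L x i| ≤ ‖x‖) (hM : 0 < M) (p : ℝ) (J K : ℕ)
    (μ : Measure E) [IsFiniteMeasure μ] {n : ℕ} (hn : 0 < n) (y : Fin n → E) :
    cellSum L e M p J (empiricalMeasure y) μ ≤ ENNReal.ofReal (innerSum L e M p J K μ y) +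
      ∑ j ∈ Finset.range (J + 1), (∫⁻ x, tailWeight p K j (shell e M x) ∂(empiricalMeasure y) +
        ∫⁻ x, tailWeight p K j (shell e M x) ∂μ) := by
  classical
  rw [ofReal_innerSum L e M p J K μ hn y, ← Finset.sum_add_distrib, cellSum]
  refine Finset.sum_le_sum fun j _ => ?_
  set w : ℕ × (Fin d → ℤ) → ℝ≥0∞ := fun Q => ENNReal.ofReal (cellWeight p Q.1 j) *
    absDiff (empiricalMeasure y (cell L e M j ⁻¹' {Q})) (μ (cell L e M j ⁻¹' {Q})) with hw
  have h1 : ∀ ν : Measure E, ∫⁻ x, tailWeight p K j (shell e M x) ∂ν =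
      ∑' Q : ℕ × (Fin d → ℤ), tailWeight p K j Q.1 * ν (cell L e M j ⁻¹' {Q}) := fun ν =>
    lintegral_fiber (measurable_cell L e M j) ν (fun Q => tailWeight p K j Q.1)
  rw [h1, h1, ← ENNReal.tsum_add]
  have h2 : ∑ Q ∈ innerCells d K j, w Q = ∑' Q, if Q ∈ innerCells d K j then w Q else 0 := by
    rw [tsum_eq_sum (s := innerCells d K j) fun Q hQ => if_neg hQ]
    exact Finset.sum_congr rfl fun Q hQ => (if_pos hQ).symm
  change ∑' Q, w Q ≤ ∑ Q ∈ innerCells d K j, w Q + _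
  rw [h2, ← ENNReal.tsum_add]
  refine ENNReal.tsum_le_tsum fun Q => ?_
  by_cases hQ : Q ∈ innerCells d K j
  · rw [if_pos hQ]; exact le_self_add
  · rw [if_neg hQ, zero_add]
    by_cases hK : K < Q.1
    · simp only [hw, tailWeight, if_pos hK]
      rw [← mul_add]
      gcongr
      exact absDiff_le_add _ _
    · have hv : Q.2 ∉ cellPositions d j := fun hv => hQ (by
        rw [innerCells, Finset.mem_product, Finset.mem_range]
        exact ⟨by omega, hv⟩)
      have h3 : cell L e M j ⁻¹' {Q} = ∅ := cell_preimage_eq_empty hL hM j Q.1 hv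
      simp [hw, h3, absDiff_zero]

end InnerSum

/-! ### Counting sample points in a set -/

section IIDTail

variable {X : Type*} [MeasurableSpace X] {Ω : Type*} [MeasurableSpace Ω] {P : Measure Ω}
  [IsProbabilityMeasure P] {μ : Measure X} {n : ℕ} {x : Fin n → Ω → X}

theorem IsIIDSample.map_eq_pi (hx : IsIIDSample P μ x) :
    P.map (fun ω i => x i ω) = Measure.pi fun _ => μ := by
  rw [(iIndepFun_iff_map_fun_eq_pi_map fun i => (hx.measurable i).aemeasurable).1 hx.indep]
  simp_rw [hx.law]

theorem IsIIDSample.measurable_pi (hx : IsIIDSample P μ x) : Measurable fun ω i => x i ω :=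
  measurable_pi_lambda _ hx.measurable

variable [IsProbabilityMeasure μ]

/-- Chernoff bound for the number of sample points falling into a set. -/
theorem IsIIDSample.measureReal_le_sum_indicator (hx : IsIIDSample P μ x) {Q : Set X}
    (hQ : MeasurableSet Q) {l : ℝ} (hl : 0 ≤ l) (a : ℝ) :
    P.real {ω | a ≤ ∑ i, Q.indicator (1 : X → ℝ) (x i ω)} ≤
      Real.exp (-l * a) * Real.exp (n * μ.real Q * Real.exp l) := by
  have hm : ∀ i, Measurable fun ω => Q.indicator (1 : X → ℝ) (x i ω) := fun i =>
    (measurable_one.indicator hQ).comp (hx.measurable i)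
  have hi : iIndepFun (fun i ω => Q.indicator (1 : X → ℝ) (x i ω)) P :=
    hx.indep.comp (fun _ => Q.indicator (1 : X → ℝ)) (fun _ => measurable_one.indicator hQ)
  have hb : ∀ (z : X), 0 ≤ Q.indicator (1 : X → ℝ) z ∧ Q.indicator (1 : X → ℝ) z ≤ 1 := fun z => by
    by_cases h : z ∈ Q <;> simp [h]
  have hmgf : ∀ i, mgf (fun ω => Q.indicator (1 : X → ℝ) (x i ω)) P l ≤
      Real.exp (μ.real Q * Real.exp l) := by
    intro i
    -- An indicator takes only the values 0 and 1, so its exponential is affine in it.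
    have h1 : ∀ ω, Real.exp (l * Q.indicator (1 : X → ℝ) (x i ω)) =
        1 + (Real.exp l - 1) * Q.indicator (1 : X → ℝ) (x i ω) := fun ω => by
      by_cases h : x i ω ∈ Q <;> simp [h]
    rw [mgf]
    simp_rw [h1]
    have hint : Integrable (fun ω => Q.indicator (1 : X → ℝ) (x i ω)) P :=
      (hx.memLp_indicator hQ i 1).integrable le_rfl
    rw [integral_add (integrable_const _) (hint.const_mul _), integral_const_mul,
      hx.integral_indicator hQ i]
    simp only [integral_const, probReal_univ, smul_eq_mul, mul_one]
    have h2 := Real.add_one_le_exp (μ.real Q * Real.exp l)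
    have h3 : 0 ≤ μ.real Q := measureReal_nonneg
    nlinarith
  have hsum := hi.mgf_sum hm Finset.univ (t := l)
  have hint : Integrable (fun ω => Real.exp (l * (∑ i, fun ω =>
      Q.indicator (1 : X → ℝ) (x i ω)) ω)) P := by
    refine Integrable.of_bound (Real.measurable_exp.comp (measurable_const.mul ?_)).aestronglyMeasurable
      (Real.exp (l * n)) (Filter.Eventually.of_forall fun ω => ?_)
    · have : (∑ i, fun ω => Q.indicator (1 : X → ℝ) (x i ω)) =
          fun ω => ∑ i, Q.indicator (1 : X → ℝ) (x i ω) := by ext ω; simp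
      rw [this]
      exact Finset.measurable_sum _ fun i _ => hm i
    · rw [Real.norm_eq_abs, Real.abs_exp]
      gcongr
      rw [Finset.sum_apply]
      calc _ ≤ ∑ _i : Fin n, (1 : ℝ) := Finset.sum_le_sum fun i _ => (hb _).2
        _ = n := by simp
  have h := measure_ge_le_exp_mul_mgf a hl hint
  rw [hsum] at h
  simp only [Finset.sum_apply] at h
  refine h.trans ?_
  gcongr
  calc _ ≤ ∏ _i : Fin n, Real.exp (μ.real Q * Real.exp l) :=
        Finset.prod_le_prod (fun i _ => mgf_nonneg) fun i _ => hmgf i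
    _ = _ := by
        rw [Finset.prod_const, Finset.card_univ, Fintype.card_fin, ← Real.exp_nat_mul, mul_assoc]

/-- By independence all points lie in `B` with probability `μ(B)^n ≥ (1-η)^n`; this produces the
first term of the concentration bound. -/
theorem IsIIDSample.measure_exists_notMem_le (hx : IsIIDSample P μ x) {B : Set X}
    (hB : MeasurableSet B) {η : ℝ} (hη1 : η ≤ 1) (h : μ.real Bᶜ ≤ η) :
    P {ω | ∃ i, x i ω ∉ B} ≤ ENNReal.ofReal (1 - (1 - η) ^ n) := by
  have hmeas : MeasurableSet {ω | ∀ i, x i ω ∈ B} := by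
    have : {ω | ∀ i, x i ω ∈ B} = ⋂ i, x i ⁻¹' B := by ext ω; simp
    rw [this]
    exact MeasurableSet.iInter fun i => hx.measurable i hB
  have h1 : P.real {ω | ∀ i, x i ω ∈ B} = μ.real B ^ n := by
    have e : {ω | ∀ i, x i ω ∈ B} = (fun ω i => x i ω) ⁻¹' (Set.univ.pi fun _ => B) := by
      ext ω; simp
    rw [e, measureReal_def, ← Measure.map_apply hx.measurable_pi
      (MeasurableSet.univ_pi fun _ => hB), hx.map_eq_pi, Measure.pi_pi]
    simp [measureReal_def]
  have h2 : {ω | ∃ i, x i ω ∉ B} = {ω | ∀ i, x i ω ∈ B}ᶜ := by ext ω; simp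
  have h3 : 1 - η ≤ μ.real B := by
    have := probReal_compl_eq_one_sub (μ := μ) hB
    linarith
  rw [h2, ← ofReal_measureReal, probReal_compl_eq_one_sub hmeas, h1]
  apply ENNReal.ofReal_le_ofReal
  have : (1 - η) ^ n ≤ μ.real B ^ n := pow_le_pow_left₀ (by linarith) h3 n
  linarith

end IIDTail

/-! ### Contribution of the outer shells -/

section OuterPart

variable {E : Type*} [NormedAddCommGroup E] [MeasurableSpace E] {e : E} {M : ℝ}

theorem lintegral_empiricalMeasure {n : ℕ} (y : Fin n → E) {f : E → ℝ≥0∞} (hf : Measurable f) :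
    ∫⁻ x, f x ∂(empiricalMeasure y) = (n : ℝ≥0∞)⁻¹ * ∑ i, f (y i) := by
  rw [empiricalMeasure, lintegral_smul_measure, lintegral_finsetSum_measure]
  simp [lintegral_dirac' _ hf]

variable [BorelSpace E]

/-- The set of points outside of the shells `0, …, K`. -/
def outerSet (e : E) (M : ℝ) (K : ℕ) : Set E := {x | K < shell e M x}

theorem measurableSet_outerSet (e : E) (M : ℝ) (K : ℕ) : MeasurableSet (outerSet e M K) :=
  measurable_shell e M (measurableSet_Ioi (a := K))

/-- A point within `M T` of `e` in a shell of positive index `k` has `2^k < 2T`. Each outer sample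
point therefore costs at most `(2T)^p` per unit of `2^(-pj)`, and only their number matters. -/
theorem lintegral_tailWeight_empiricalMeasure_le (hM : 0 < M) {p T : ℝ} (hp : 0 ≤ p) (hT : 0 ≤ T)
    (K j : ℕ) {n : ℕ} (hn : 0 < n) (y : Fin n → E) (hy : ∀ i, ‖y i - e‖ ≤ M * T) :
    ∫⁻ x, tailWeight p K j (shell e M x) ∂(empiricalMeasure y) ≤
      ENNReal.ofReal (cellWeight p 0 j *
        ((2 * T) ^ p * ((∑ i, (outerSet e M K).indicator (1 : E → ℝ) (y i)) / n))) := by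
  have hn' : (0 : ℝ) < n := by exact_mod_cast hn
  have hind : ∀ z, 0 ≤ (outerSet e M K).indicator (1 : E → ℝ) z := fun z =>
    Set.indicator_nonneg (fun _ _ => zero_le_one) _
  have hw := (cellWeight_pos p 0 j).le
  rw [lintegral_empiricalMeasure y (f := fun x => tailWeight p K j (shell e M x))
    ((measurable_of_countable (tailWeight p K j)).comp
    (measurable_shell e M))]
  have h1 : ∀ i, tailWeight p K j (shell e M (y i)) ≤ ENNReal.ofReal (cellWeight p 0 j * (2 * T) ^ p *
      (outerSet e M K).indicator (1 : E → ℝ) (y i)) := by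
    intro i
    by_cases h : K < shell e M (y i)
    · have hm : y i ∈ outerSet e M K := h
      rw [tailWeight, if_pos h, Set.indicator_of_mem hm, Pi.one_apply, mul_one]
      apply ENNReal.ofReal_le_ofReal
      have h2 := shell_lt_norm_sub e hM (x := y i) (by omega)
      have h3 : (2 : ℝ) ^ shell e M (y i) ≤ 2 * T := by
        have := hy i
        by_contra hcon
        push Not at hcon
        nlinarith
      rw [cellWeight_eq, cellWeight_eq, pow_zero, one_mul, mul_comm]
      gcongr
      rw [← Real.rpow_natCast, ← Real.rpow_mul two_pos.le, mul_comm, Real.rpow_mul two_pos.le,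
        Real.rpow_natCast]
      gcongr
    · rw [tailWeight, if_neg h]; exact zero_le
  calc _ ≤ (n : ℝ≥0∞)⁻¹ * ∑ i, ENNReal.ofReal (cellWeight p 0 j * (2 * T) ^ p *
      (outerSet e M K).indicator (1 : E → ℝ) (y i)) := by
        gcongr with i
        exact h1 i
    _ = _ := by
        rw [← ENNReal.ofReal_sum_of_nonneg fun i _ => mul_nonneg (by positivity) (hind _),
          ← Finset.mul_sum, ← ENNReal.ofReal_natCast, ← ENNReal.ofReal_inv_of_pos hn',
          ← ENNReal.ofReal_mul (by positivity)]
        congr 1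
        field_simp

theorem lintegral_tailWeight_le (hM : 0 < M) {p q : ℝ} {μ : Measure E} [IsProbabilityMeasure μ]
    (hq : 0 < q) (hpq : p < q) (hmom : momentNorm q e μ ≤ ENNReal.ofReal M) (K j : ℕ) :
    ∫⁻ x, tailWeight p K j (shell e M x) ∂μ ≤
      ENNReal.ofReal (cellWeight p 0 j *
        (2 ^ q * ((2 : ℝ) ^ (p - q)) ^ (K + 1) * (1 - (2 : ℝ) ^ (p - q))⁻¹)) := by
  have hr1 : (2 : ℝ) ^ (p - q) < 1 :=
    Real.rpow_lt_one_of_one_lt_of_neg one_lt_two (by linarith)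
  rw [lintegral_fiber (measurable_shell e M) μ (tailWeight p K j),
    ← ENNReal.summable.sum_add_tsum_nat_add' (k := K + 1),
    ← ofReal_tsum_geometric_mul (A := cellWeight p 0 j * (2 ^ q * ((2 : ℝ) ^ (p - q)) ^ (K + 1)))
    (by have := (cellWeight_pos p 0 j).le; positivity) (by positivity) hr1 (by ring)]
  rw [Finset.sum_eq_zero, zero_add]
  · refine ENNReal.tsum_le_tsum fun k => ?_
    rw [tailWeight, if_pos (by omega), ← ofReal_measureReal,
      ← ENNReal.ofReal_mul (cellWeight_pos p _ j).le]
    apply ENNReal.ofReal_le_ofReal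
    have h3 : (2 : ℝ) ^ (p - q) = 2 ^ p * 2 ^ (- q) := by
      rw [← Real.rpow_add two_pos]; ring_nf
    rw [cellWeight_eq, cellWeight_eq, pow_zero, one_mul, h3]
    have hA := mul_le_mul_of_nonneg_left (measureReal_shell_le hq hM hmom (k + (K + 1)))
      (show 0 ≤ ((2 : ℝ) ^ p) ^ (k + (K + 1)) * ((2 : ℝ) ^ (-p)) ^ j by positivity)
    refine hA.trans (le_of_eq ?_)
    rw [mul_pow, mul_pow, pow_add, pow_add ((2 : ℝ) ^ (-q))]
    ring
  · intro k hk
    rw [Finset.mem_range] at hk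
    rw [tailWeight, if_neg (by omega), zero_mul]

/-- The outer shells start at index `K + 1`, which compensates the halved radius, so Markov applies
at radius `M 2^K` without a factor `2^q`. -/
theorem measureReal_outerSet_le (hM : 0 < M) {q : ℝ} {μ : Measure E}
    (hq : 0 < q) (hmom : momentNorm q e μ ≤ ENNReal.ofReal M) (K : ℕ) :
    μ.real (outerSet e M K) ≤ ((2 : ℝ) ^ K)⁻¹ ^ q := by
  have h1 := measure_le_norm_sub_le hq hM hmom (r := M * 2 ^ K) (by positivity)
  have h2 : μ (outerSet e M K) ≤ ENNReal.ofReal ((M / (M * 2 ^ K)) ^ q) := by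
    refine (measure_mono fun x hx => ?_).trans h1
    have hx' : K + 1 ≤ shell e M x := hx
    have h3 := shell_lt_norm_sub e hM (x := x) (by omega)
    have h4 : (2 : ℝ) ^ (K + 1) ≤ 2 ^ shell e M x := pow_le_pow_right₀ one_le_two hx'
    change M * 2 ^ K ≤ ‖x - e‖
    rw [pow_succ] at h4
    nlinarith
  have h3 := ENNReal.toReal_mono ENNReal.ofReal_ne_top h2
  rw [ENNReal.toReal_ofReal (by positivity), div_mul_cancel_left₀ hM.ne'] at h3
  exact h3

variable [NormedSpace ℝ E] [FiniteDimensional ℝ E] {d : ℕ} {L : E →ₗ[ℝ] (Fin d → ℝ)}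

/-- The factor 2 bounds the sum of `2^(-pj)` over the generations, where `p ≥ 1` is used. -/
theorem cellSum_le_of_norm_le (hL : ∀ x i, |L x i| ≤ ‖x‖) (hM : 0 < M) {p q T : ℝ} (hp : 1 ≤ p)
    (hT : 0 ≤ T) {μ : Measure E} [IsProbabilityMeasure μ] (hpq : p < q)
    (hmom : momentNorm q e μ ≤ ENNReal.ofReal M) (J K : ℕ)
    {n : ℕ} (hn : 0 < n) (y : Fin n → E) (hy : ∀ i, ‖y i - e‖ ≤ M * T) :
    cellSum L e M p J (empiricalMeasure y) μ ≤ ENNReal.ofReal (innerSum L e M p J K μ y +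
      2 * ((2 * T) ^ p * ((∑ i, (outerSet e M K).indicator (1 : E → ℝ) (y i)) / n) +
        2 ^ q * ((2 : ℝ) ^ (p - q)) ^ (K + 1) * (1 - (2 : ℝ) ^ (p - q))⁻¹)) := by
  have hq : 0 < q := by linarith
  have hr1 : (2 : ℝ) ^ (p - q) < 1 :=
    Real.rpow_lt_one_of_one_lt_of_neg one_lt_two (by linarith)
  have hr1' : 0 < (1 - (2 : ℝ) ^ (p - q))⁻¹ := inv_pos.2 (by linarith)
  set a := (2 * T) ^ p * ((∑ i, (outerSet e M K).indicator (1 : E → ℝ) (y i)) / n) with ha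
  set b := 2 ^ q * ((2 : ℝ) ^ (p - q)) ^ (K + 1) * (1 - (2 : ℝ) ^ (p - q))⁻¹ with hb
  have ha0 : 0 ≤ a := mul_nonneg (by positivity) (div_nonneg (Finset.sum_nonneg fun i _ =>
    Set.indicator_nonneg (fun _ _ => zero_le_one) _) (by positivity))
  have hb0 : 0 ≤ b := by positivity
  refine (cellSum_le_innerSum_add hL hM p J K μ hn y).trans ?_
  rw [ENNReal.ofReal_add (innerSum_nonneg L e M p J K μ y) (by positivity)]
  gcongr
  calc _ ≤ ∑ j ∈ Finset.range (J + 1), (ENNReal.ofReal (cellWeight p 0 j * a) +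
        ENNReal.ofReal (cellWeight p 0 j * b)) := by
        gcongr with j
        · exact lintegral_tailWeight_empiricalMeasure_le hM (by linarith) hT K j hn y hy
        · exact lintegral_tailWeight_le hM hq hpq hmom K j
    _ = ENNReal.ofReal (∑ j ∈ Finset.range (J + 1), cellWeight p 0 j * (a + b)) := by
        have hw := fun j => (cellWeight_pos p 0 j).le
        rw [ENNReal.ofReal_sum_of_nonneg fun j _ => mul_nonneg (hw j) (by positivity)]
        refine Finset.sum_congr rfl fun j _ => ?_
        rw [mul_add, ENNReal.ofReal_add (mul_nonneg (hw j) ha0) (mul_nonneg (hw j) hb0)]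
    _ ≤ ENNReal.ofReal (2 * (a + b)) := by
        apply ENNReal.ofReal_le_ofReal
        rw [← Finset.sum_mul]
        have := sum_cellWeight_le hp 0 J
        rw [pow_zero, mul_one] at this
        gcongr

end OuterPart

/-! ### Concentration when truncation rarely matters -/

section Concentration

variable {E : Type*} [NormedAddCommGroup E] [NormedSpace ℝ E] [FiniteDimensional ℝ E]
  [MeasurableSpace E] [BorelSpace E] {d : ℕ} {L : E →ₗ[ℝ] (Fin d → ℝ)} {e : E} {M : ℝ}
  {Ω : Type*} [MeasurableSpace Ω] {P : Measure Ω} [IsProbabilityMeasure P]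
  {μ : Measure E} [IsProbabilityMeasure μ] {n : ℕ} {x : Fin n → Ω → E}

/-- Concentration of the inner part of the multiscale distance. -/
theorem IsIIDSample.measureReal_innerSum_ge_le (hx : IsIIDSample P μ x) (hn : 0 < n) {p A : ℝ}
    (hp : 1 ≤ p) (hA : 0 ≤ A) {J K : ℕ}
    (hcell : ∫⁻ ω, cellSum L e M p J (empiricalMeasure (fun i => x i ω)) μ ∂P ≤ ENNReal.ofReal A)
    {t : ℝ} (ht : 0 ≤ t) :
    P.real {ω | A + t ≤ innerSum L e M p J K μ fun i => x i ω} ≤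
      Real.exp (-(n * t ^ 2 / (32 * (((2 : ℝ) ^ p) ^ K) ^ 2))) := by
  have hn' : (0 : ℝ) < n := by exact_mod_cast hn
  have hm := measurable_innerSum L e M p J K μ n
  have hB := fun y : Fin n → E => abs_innerSum_le L e M p J K μ hn y
  have hE : ∫ y, innerSum L e M p J K μ y ∂(Measure.pi fun _ : Fin n => μ) ≤ A := by
    rw [← hx.map_eq_pi, integral_map hx.measurable_pi.aemeasurable hm.aestronglyMeasurable,
      integral_eq_lintegral_of_nonneg_ae
        (Filter.Eventually.of_forall fun ω => innerSum_nonneg L e M p J K μ _)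
        (hm.comp hx.measurable_pi).aestronglyMeasurable]
    refine ENNReal.toReal_le_of_le_ofReal hA (le_trans (lintegral_mono fun ω => ?_) hcell)
    exact ofReal_innerSum_le_cellSum L e M p J K μ hn _
  have h := measureReal_pi_ge_le_of_bounded_differences μ hm hB (c := 4 * ((2 : ℝ) ^ p) ^ K / n)
    (by positivity) (fun y i z => abs_innerSum_sub_update_le L e M hp J K μ y i z) ht
  have hset : MeasurableSet {y : Fin n → E | A + t ≤ innerSum L e M p J K μ y} :=
    measurableSet_le measurable_const hm
  calc P.real {ω | A + t ≤ innerSum L e M p J K μ fun i => x i ω}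
      = (Measure.pi fun _ : Fin n => μ).real {y | A + t ≤ innerSum L e M p J K μ y} := by
        rw [← hx.map_eq_pi, map_measureReal_apply hx.measurable_pi hset]
        rfl
    _ ≤ (Measure.pi fun _ : Fin n => μ).real {y |
          ∫ y, innerSum L e M p J K μ y ∂(Measure.pi fun _ => μ) + t ≤ innerSum L e M p J K μ y} := by
        refine measureReal_mono fun y hy => ?_
        have hy' : A + t ≤ innerSum L e M p J K μ y := hy
        change _ ≤ innerSum L e M p J K μ y
        linarith
    _ ≤ _ := h
    _ = _ := by
        congr 2
        field_simp
        ring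

/-- Either the inner part or the number of outer points is large when the Wasserstein distance of a
sample contained in the ball of radius `M T` is large. -/
theorem innerSum_or_outer_of_wasserstein_ge (hd : 1 ≤ d) (hL : ∀ x i, |L x i| ≤ ‖x‖)
    (hL' : ∀ x, ‖x‖ ≤ d * ‖L x‖) (hM : 0 < M) {p q T A θ κ : ℝ} (hp : 1 ≤ p) (hpq : p < q)
    (hT : 0 < T) (hA : 0 ≤ A) (hθ : 0 < θ) (hκ : (2 * d) ^ p * (2 * A) ≤ κ)
    (hmom : momentNorm q e μ ≤ ENNReal.ofReal M) {J K : ℕ}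
    (hbase : ∫⁻ y, ENNReal.ofReal (cellWeight p (shell e M y) J) ∂μ ≤ ENNReal.ofReal A)
    (hTK : T ≤ 64 * d * 2 ^ (K + 1))
    (hsmall : (2 * d) ^ p * (2 * 2 ^ q * (64 * d) ^ (q - p) * (1 - (2 : ℝ) ^ (p - q))⁻¹) *
      T ^ (-q) ≤ θ / 4)
    (hn : 0 < n) (y : Fin n → E) (hy : ∀ i, ‖y i - e‖ ≤ M * T)
    (hW : ENNReal.ofReal (M ^ p * (κ + θ * T ^ p)) ≤ wasserstein p (empiricalMeasure y) μ ^ p) :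
    A + θ * T ^ p / (2 * (2 * d) ^ p) ≤ innerSum L e M p J K μ y ∨
      n * θ / (8 * (4 * d) ^ p) ≤ ∑ i, (outerSet e M K).indicator (1 : E → ℝ) (y i) := by
  have hn' : (0 : ℝ) < n := by exact_mod_cast hn
  have hd' : (1 : ℝ) ≤ d := by exact_mod_cast hd
  have hd0 : (0 : ℝ) < d := by linarith
  have := isProbabilityMeasure_empiricalMeasure hn y
  have hr1 : (2 : ℝ) ^ (p - q) < 1 :=
    Real.rpow_lt_one_of_one_lt_of_neg one_lt_two (by linarith)
  have hr1' : 0 < (1 - (2 : ℝ) ^ (p - q))⁻¹ := inv_pos.2 (by linarith)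
  set N := ∑ i, (outerSet e M K).indicator (1 : E → ℝ) (y i) with hN
  have hN0 : 0 ≤ N := Finset.sum_nonneg fun i _ => Set.indicator_nonneg (fun _ _ => zero_le_one) _
  set b := 2 ^ q * ((2 : ℝ) ^ (p - q)) ^ (K + 1) * (1 - (2 : ℝ) ^ (p - q))⁻¹ with hb
  have hb0 : 0 ≤ b := by positivity
  set G := innerSum L e M p J K μ y with hG
  have hG0 : 0 ≤ G := innerSum_nonneg L e M p J K μ y
  have hpow : 0 < (2 * d : ℝ) ^ p := by positivity
  have hTp : 0 < T ^ p := by positivity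
  have hMp : 0 < M ^ p := by positivity
  -- The level `κ` pays for the discretisation error and for the mean of the inner sum, `A` each.
  -- The excess `θ T^p` is then split: one half for the inner fluctuation, a quarter for outer
  -- sample points, a quarter for the tail of `μ`.
  have h1 : M ^ p * (κ + θ * T ^ p) ≤
      (2 * d * M) ^ p * (A + (G + 2 * ((2 * T) ^ p * (N / n) + b))) := by
    have h2 := hW.trans (wasserstein_rpow_le_cellSum hL' hd e hM (by linarith : 0 < p) J
      (empiricalMeasure y) μ)
    have h3 := cellSum_le_of_norm_le hL hM hp hT.le hpq hmom J K hn y hy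
    have h4 : 0 ≤ G + 2 * ((2 * T) ^ p * (N / n) + b) := by positivity
    have h5 : ENNReal.ofReal (M ^ p * (κ + θ * T ^ p)) ≤ ENNReal.ofReal
        ((2 * d * M) ^ p * (A + (G + 2 * ((2 * T) ^ p * (N / n) + b)))) := by
      rw [ENNReal.ofReal_mul (p := (2 * d * M) ^ p) (by positivity), ENNReal.ofReal_add hA h4]
      exact h2.trans (mul_le_mul_right (add_le_add hbase h3) _)
    exact (ENNReal.ofReal_le_ofReal_iff (by positivity)).1 h5
  rw [Real.mul_rpow (by positivity) hM.le, mul_comm ((2 * d : ℝ) ^ p), mul_assoc,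
    mul_le_mul_iff_right₀ hMp] at h1
  -- Since `T ≤ 64 d 2^(K+1)`, the tail of `μ` beyond shell `K` is of order `T^(p-q)`, that is
  -- `T^(-q)` relative to `T^p`.
  have hbT : (2 * d) ^ p * (2 * b) ≤ θ / 4 * T ^ p := by
    have h6 : ((2 : ℝ) ^ (p - q)) ^ (K + 1) ≤ (64 * d) ^ (q - p) * (T ^ (-q) * T ^ p) := by
      rw [← Real.rpow_add hT, ← Real.rpow_natCast, ← Real.rpow_mul two_pos.le, mul_comm (p - q),
        Real.rpow_mul two_pos.le, Real.rpow_natCast, show -q + p = -(q - p) by ring,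
        show p - q = -(q - p) by ring, Real.rpow_neg hT.le, Real.rpow_neg (by positivity),
        ← div_eq_mul_inv, inv_eq_one_div, div_le_div_iff₀ (by positivity) (by positivity), one_mul,
        ← Real.mul_rpow (by positivity) (by positivity)]
      exact Real.rpow_le_rpow hT.le hTK (by linarith)
    calc (2 * d) ^ p * (2 * b) ≤ (2 * d) ^ p * (2 * (2 ^ q *
          ((64 * d) ^ (q - p) * (T ^ (-q) * T ^ p)) * (1 - (2 : ℝ) ^ (p - q))⁻¹)) := by
          rw [hb]; gcongr
      _ = ((2 * d) ^ p * (2 * 2 ^ q * (64 * d) ^ (q - p) * (1 - (2 : ℝ) ^ (p - q))⁻¹) *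
          T ^ (-q)) * T ^ p := by ring
      _ ≤ _ := by gcongr
  by_contra hcon
  push Not at hcon
  obtain ⟨hc1, hc2⟩ := hcon
  have hc1' : (2 * d) ^ p * (G - A) < θ / 2 * T ^ p := by
    have h8 : G - A < θ * T ^ p / (2 * (2 * d) ^ p) := by linarith
    calc (2 * d) ^ p * (G - A) < (2 * d) ^ p * (θ * T ^ p / (2 * (2 * d) ^ p)) := by gcongr
      _ = _ := by field_simp
  have hc2' : (2 * d) ^ p * (2 * ((2 * T) ^ p * (N / n))) ≤ θ / 4 * T ^ p := by
    have h9 : N / n ≤ θ / (8 * (4 * d) ^ p) := by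
      rw [div_le_iff₀ hn']
      calc N ≤ n * θ / (8 * (4 * d) ^ p) := hc2.le
        _ = _ := by ring
    calc (2 * d) ^ p * (2 * ((2 * T) ^ p * (N / n)))
        ≤ (2 * d) ^ p * (2 * ((2 * T) ^ p * (θ / (8 * (4 * d) ^ p)))) := by gcongr
      _ = _ := by
          rw [show (4 * d : ℝ) = 2 * d * 2 by ring, Real.mul_rpow (by positivity) two_pos.le,
            Real.mul_rpow two_pos.le hT.le]
          field_simp
          ring
  have e1 : (2 * d : ℝ) ^ p * (A + (G + 2 * ((2 * T) ^ p * (N / n) + b))) =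
      (2 * d) ^ p * (2 * A) + (2 * d) ^ p * (G - A) +
        (2 * d) ^ p * (2 * ((2 * T) ^ p * (N / n))) + (2 * d) ^ p * (2 * b) := by ring
  linarith

/-- The concentration inequality in the regime where truncation at the radius `M T` is unlikely to
affect the sample. -/
theorem IsIIDSample.measure_wasserstein_ge_le (hx : IsIIDSample P μ x) (hn : 0 < n) (hd : 1 ≤ d)
    (hL : ∀ x i, |L x i| ≤ ‖x‖) (hL' : ∀ x, ‖x‖ ≤ d * ‖L x‖) (hM : 0 < M) {p q T A θ κ η : ℝ}
    (hp : 1 ≤ p) (hpq : p < q) (hT : 0 < T) (hη1 : η ≤ 1) (hηT : T ^ (-q) = η) (hA : 0 ≤ A)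
    (hθ : 0 < θ) (hκ : (2 * d) ^ p * (2 * A) ≤ κ) (hmom : momentNorm q e μ ≤ ENNReal.ofReal M)
    {J : ℕ} (hbase : ∫⁻ y, ENNReal.ofReal (cellWeight p (shell e M y) J) ∂μ ≤ ENNReal.ofReal A)
    (hcell : ∫⁻ ω, cellSum L e M p J (empiricalMeasure (fun i => x i ω)) μ ∂P ≤ ENNReal.ofReal A)
    (hTd : 64 * d ≤ T)
    (hsmall : (2 * d) ^ p * (2 * 2 ^ q * (64 * d) ^ (q - p) * (1 - (2 : ℝ) ^ (p - q))⁻¹) * η ≤ θ / 4)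
    (hcount : n * η * ((128 * d) ^ q * Real.exp (4 * (8 * (4 * d : ℝ) ^ p) ^ 2)) ≤ 1 / 2)
    (hexp : Real.exp (-(2 * n * θ ^ 2)) ≤ 1 / 3) :
    P {ω | ENNReal.ofReal (M ^ p * (κ + θ * T ^ p)) ≤
        wasserstein p (empiricalMeasure fun i => x i ω) μ ^ p} ≤
      ENNReal.ofReal (1 - (1 - η) ^ n + Real.exp (-(2 * n * θ ^ 2))) := by
  have hn' : (0 : ℝ) < n := by exact_mod_cast hn
  have hd' : (1 : ℝ) ≤ d := by exact_mod_cast hd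
  have hd0 : (0 : ℝ) < d := by linarith
  have hp0 : 0 < p := by linarith
  have hq : 0 < q := by linarith
  have hη0 : 0 ≤ η := by rw [← hηT]; positivity
  have hpow : 0 < (2 * d : ℝ) ^ p := by positivity
  have hTp : 0 < T ^ p := by positivity
  -- The inner region ends near `T / (64 d)` rather than `T`. This margin makes up for the non-sharp
  -- McDiarmid constant, the 4 in the bounded differences and the factor `2d`.
  obtain ⟨K, hK1, hK2⟩ := exists_nat_pow_near (x := T / (64 * d)) (y := 2)
    ((one_le_div (by positivity)).2 hTd) one_lt_two
  rw [le_div_iff₀ (by positivity)] at hK1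
  rw [div_lt_iff₀ (by positivity)] at hK2
  set B := 8 * (4 * d : ℝ) ^ p with hB
  have hB0 : 0 < B := by positivity
  set S₁ := {ω | ∃ i, x i ω ∉ Metric.closedBall e (M * T)} with hS₁
  set S₂ := {ω | A + θ * T ^ p / (2 * (2 * d) ^ p) ≤ innerSum L e M p J K μ fun i => x i ω} with hS₂
  set S₃ := {ω | n * θ / B ≤ ∑ i, (outerSet e M K).indicator (1 : E → ℝ) (x i ω)} with hS₃
  have hsub : {ω | ENNReal.ofReal (M ^ p * (κ + θ * T ^ p)) ≤
      wasserstein p (empiricalMeasure fun i => x i ω) μ ^ p} ⊆ S₁ ∪ (S₂ ∪ S₃) := by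
    intro ω hω
    by_cases h1 : ∃ i, x i ω ∉ Metric.closedBall e (M * T)
    · exact Or.inl h1
    · push Not at h1
      right
      refine innerSum_or_outer_of_wasserstein_ge hd hL hL' hM hp hpq hT hA hθ hκ hmom hbase
        (by linarith) (by rw [hηT]; exact hsmall) hn (fun i => x i ω) (fun i => ?_) hω
      have := h1 i
      rwa [Metric.mem_closedBall, dist_eq_norm] at this
  have hP₁ : P S₁ ≤ ENNReal.ofReal (1 - (1 - η) ^ n) := by
    refine hx.measure_exists_notMem_le Metric.isClosed_closedBall.measurableSet hη1 ?_
    refine ENNReal.toReal_le_of_le_ofReal hη0 ?_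
    refine (measure_mono fun z hz => ?_).trans
      ((measure_le_norm_sub_le hq hM hmom (r := M * T) (by positivity)).trans (le_of_eq ?_))
    · rw [Set.mem_compl_iff, Metric.mem_closedBall, dist_eq_norm, not_le] at hz
      exact hz.le
    · rw [div_mul_cancel_left₀ hM.ne', Real.inv_rpow hT.le, ← Real.rpow_neg hT.le, hηT]
  have hP₂ : P.real S₂ ≤ Real.exp (-(4 * n * θ ^ 2)) := by
    refine (hx.measureReal_innerSum_ge_le hn hp hA hcell (by positivity)).trans ?_
    apply Real.exp_le_exp.2
    rw [neg_le_neg_iff, le_div_iff₀ (by positivity)]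
    have h2 : (2 * d) ^ p * ((2 : ℝ) ^ p) ^ K ≤ T ^ p / 32 := by
      have e1 : ((2 : ℝ) ^ p) ^ K = ((2 : ℝ) ^ K) ^ p := by
        rw [← Real.rpow_natCast, ← Real.rpow_natCast, ← Real.rpow_mul two_pos.le,
          ← Real.rpow_mul two_pos.le, mul_comm]
      have e2 : (2 * d : ℝ) * 2 ^ K ≤ T * (1 / 32) := by linarith
      rw [e1, ← Real.mul_rpow (by positivity) (by positivity)]
      calc ((2 * d : ℝ) * 2 ^ K) ^ p ≤ (T * (1 / 32)) ^ p := by gcongr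
        _ = T ^ p * (1 / 32) ^ p := Real.mul_rpow hT.le (by norm_num)
        _ ≤ T ^ p * (1 / 32) ^ (1 : ℝ) := by
            gcongr ?_ * ?_
            exact Real.rpow_le_rpow_of_exponent_ge (by norm_num) (by norm_num) hp
        _ = _ := by rw [Real.rpow_one]; ring
    have h3 : ((2 : ℝ) ^ p) ^ K ≤ T ^ p / 32 / (2 * d) ^ p := by
      rw [le_div_iff₀ hpow, mul_comm]; exact h2
    calc 4 * n * θ ^ 2 * (32 * (((2 : ℝ) ^ p) ^ K) ^ 2)
        ≤ 4 * n * θ ^ 2 * (32 * (T ^ p / 32 / (2 * d) ^ p) ^ 2) := by gcongr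
      _ = n * θ ^ 2 * (T ^ p / (2 * d) ^ p) ^ 2 * (1 / 8) := by field_simp; ring
      _ ≤ n * θ ^ 2 * (T ^ p / (2 * d) ^ p) ^ 2 * (1 / 4) := by gcongr; norm_num
      _ = _ := by field_simp; ring
  -- For `θ ≤ B`, Chernoff with `l = 4 B^2` gives the exponent `4 n B θ ≥ 4 n θ^2`, and the other
  -- factor is at most `e^(1/2) ≤ 2` since few outer points are expected. For `θ > B` the event
  -- would need more than `n` points.
  have hP₃ : P.real S₃ ≤ 2 * Real.exp (-(4 * n * θ ^ 2)) := by
    by_cases hθB : θ ≤ B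
    · have hQ := measurableSet_outerSet e M K
      refine (hx.measureReal_le_sum_indicator hQ (l := 4 * B ^ 2) (by positivity) _).trans ?_
      rw [mul_comm]
      have h4 : μ.real (outerSet e M K) ≤ (128 * d) ^ q * η := by
        refine (measureReal_outerSet_le hM hq hmom K).trans ?_
        rw [← hηT, Real.rpow_neg hT.le, ← Real.inv_rpow hT.le,
          ← Real.mul_rpow (by positivity) (by positivity)]
        apply Real.rpow_le_rpow (by positivity) _ hq.le
        rw [← div_eq_mul_inv, inv_eq_one_div, div_le_div_iff₀ (by positivity) hT]
        rw [pow_succ] at hK2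
        linarith
      have h5 : n * μ.real (outerSet e M K) * Real.exp (4 * B ^ 2) ≤ 1 / 2 := by
        calc _ ≤ n * ((128 * d) ^ q * η) * Real.exp (4 * B ^ 2) := by gcongr
          _ = n * η * ((128 * d) ^ q * Real.exp (4 * B ^ 2)) := by ring
          _ ≤ 1 / 2 := hcount
      have h6 : Real.exp (n * μ.real (outerSet e M K) * Real.exp (4 * B ^ 2)) ≤ 2 := by
        rw [← Real.le_log_iff_exp_le two_pos]
        have := Real.log_two_gt_d9
        linarith
      gcongr
      have h7 : 4 * B ^ 2 * (n * θ / B) = 4 * n * (B * θ) := by field_simp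
      rw [neg_mul, neg_le_neg_iff, h7]
      gcongr
      nlinarith
    · have : S₃ = ∅ := by
        ext ω
        simp only [hS₃, Set.mem_ofPred_eq, Set.mem_empty_iff_false, iff_false, not_le]
        push Not at hθB
        calc ∑ i, (outerSet e M K).indicator (1 : E → ℝ) (x i ω) ≤ ∑ _i : Fin n, (1 : ℝ) := by
              refine Finset.sum_le_sum fun i _ => ?_
              by_cases h : x i ω ∈ outerSet e M K <;> simp [h]
          _ = n := by simp
          _ < n * θ / B := by
              rw [lt_div_iff₀ hB0]
              gcongr
      rw [this, measureReal_empty]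
      positivity
  have hπ : 0 ≤ 1 - (1 - η) ^ n := by
    have : (1 - η) ^ n ≤ 1 := pow_le_one₀ (by linarith) (by linarith)
    linarith
  calc _ ≤ P (S₁ ∪ (S₂ ∪ S₃)) := measure_mono hsub
    _ ≤ P S₁ + (P S₂ + P S₃) :=
        (measure_union_le _ _).trans (add_le_add le_rfl (measure_union_le _ _))
    _ ≤ ENNReal.ofReal (1 - (1 - η) ^ n) + (ENNReal.ofReal (Real.exp (-(4 * n * θ ^ 2))) +
          ENNReal.ofReal (2 * Real.exp (-(4 * n * θ ^ 2)))) := by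
        refine add_le_add hP₁ (add_le_add ?_ ?_)
        · rw [← ofReal_measureReal]; exact ENNReal.ofReal_le_ofReal hP₂
        · rw [← ofReal_measureReal]; exact ENNReal.ofReal_le_ofReal hP₃
    _ = ENNReal.ofReal (1 - (1 - η) ^ n + 3 * Real.exp (-(4 * n * θ ^ 2))) := by
        rw [← ENNReal.ofReal_add (by positivity) (by positivity),
          ← ENNReal.ofReal_add hπ (by positivity)]
        congr 1
        ring
    _ ≤ _ := by
        apply ENNReal.ofReal_le_ofReal
        -- Half of the exponent is spent on the factor 3, because `exp(-2nθ^2) ≤ 1/3`.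
        have : Real.exp (-(4 * n * θ ^ 2)) =
            Real.exp (-(2 * n * θ ^ 2)) * Real.exp (-(2 * n * θ ^ 2)) := by
          rw [← Real.exp_add]; congr 1; ring
        have h8 := mul_le_mul_of_nonneg_right hexp (Real.exp_pos (-(2 * n * θ ^ 2))).le
        linarith

end Concentration

/-! ### Reduction to the small-probability regime and choice of the constant -/

section Main

theorem truncConst_nonneg {p q : ℝ} (hp : 0 < p) (hpq : p < q) : 0 ≤ truncConst p q := by
  have h1 : 0 < 1 / p - 1 / q := sub_pos.2 (one_div_lt_one_div_of_lt hp hpq)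
  have h2 : 1 < (2 : ℝ) ^ (1 / p - 1 / q) := Real.one_lt_rpow one_lt_two h1
  have h3 : 1 < (2 : ℝ) ^ (1 / p) := Real.one_lt_rpow one_lt_two (by positivity)
  have h4 : 0 < (2 : ℝ) ^ (1 / p - 1 / q) - 1 := by linarith
  have h5 : 0 < (2 : ℝ) ^ (1 / p) - 1 := by linarith
  unfold truncConst
  positivity

/-- Markov's inequality for the Wasserstein distance of a sample to its law. -/
theorem IsIIDSample.measure_wasserstein_ge_le_div {E : Type*} [NormedAddCommGroup E]
    [NormedSpace ℝ E] [FiniteDimensional ℝ E] [MeasurableSpace E] [BorelSpace E] {d : ℕ}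
    {L : E →ₗ[ℝ] (Fin d → ℝ)} {e : E} {M : ℝ} {Ω : Type*} [MeasurableSpace Ω] {P : Measure Ω}
    [IsProbabilityMeasure P] {μ : Measure E} [IsProbabilityMeasure μ] {n : ℕ} {x : Fin n → Ω → E}
    (hx : IsIIDSample P μ x) (hn : 0 < n) (hd : 1 ≤ d) (hL' : ∀ x, ‖x‖ ≤ d * ‖L x‖) (hM : 0 < M)
    {p A a : ℝ} (hp : 0 < p) (hA : 0 ≤ A) (ha : 0 < a) {J : ℕ}
    (hbase : ∫⁻ y, ENNReal.ofReal (cellWeight p (shell e M y) J) ∂μ ≤ ENNReal.ofReal A)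
    (hcell : ∫⁻ ω, cellSum L e M p J (empiricalMeasure (fun i => x i ω)) μ ∂P ≤ ENNReal.ofReal A) :
    P {ω | ENNReal.ofReal (M ^ p * a) ≤ wasserstein p (empiricalMeasure fun i => x i ω) μ ^ p} ≤
      ENNReal.ofReal ((2 * d) ^ p * (2 * A) / a) := by
  have hMp : 0 < M ^ p := by positivity
  set F : Ω → ℝ≥0∞ := fun ω => ENNReal.ofReal ((2 * d * M) ^ p) *
      (∫⁻ y, ENNReal.ofReal (cellWeight p (shell e M y) J) ∂μ +
        cellSum L e M p J (empiricalMeasure fun i => x i ω) μ) with hF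
  have hFm : Measurable F :=
    ((hx.measurable_cellSum (L := L) (e := e) (M := M) p J).const_add _).const_mul _
  have hFi : ∫⁻ ω, F ω ∂P ≤ ENNReal.ofReal (M ^ p * ((2 * d) ^ p * (2 * A))) := by
    calc ∫⁻ ω, F ω ∂P = ENNReal.ofReal ((2 * d * M) ^ p) *
          (∫⁻ y, ENNReal.ofReal (cellWeight p (shell e M y) J) ∂μ +
            ∫⁻ ω, cellSum L e M p J (empiricalMeasure fun i => x i ω) μ ∂P) := by
          rw [hF, lintegral_const_mul' _ _ ENNReal.ofReal_ne_top, lintegral_add_left measurable_const]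
          simp
      _ ≤ ENNReal.ofReal ((2 * d * M) ^ p) * (ENNReal.ofReal A + ENNReal.ofReal A) := by gcongr
      _ = _ := by
          rw [← ENNReal.ofReal_add hA hA, ← ENNReal.ofReal_mul (by positivity),
            Real.mul_rpow (by positivity) hM.le]
          congr 1
          ring
  have hpos : 0 < M ^ p * a := by positivity
  calc _ ≤ P {ω | ENNReal.ofReal (M ^ p * a) ≤ F ω} := by
        refine measure_mono fun ω hω => ?_
        have := isProbabilityMeasure_empiricalMeasure hn fun i => x i ω
        exact le_trans hω (wasserstein_rpow_le_cellSum hL' hd e hM hp J _ _)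
    _ ≤ (∫⁻ ω, F ω ∂P) / ENNReal.ofReal (M ^ p * a) :=
        meas_ge_le_lintegral_div hFm.aemeasurable (by simpa using hpos) ENNReal.ofReal_ne_top
    _ ≤ ENNReal.ofReal (M ^ p * ((2 * d) ^ p * (2 * A))) / ENNReal.ofReal (M ^ p * a) := by gcongr
    _ = _ := by
        rw [← ENNReal.ofReal_div_of_pos hpos, mul_div_mul_left _ _ hMp.ne']

/-- From `(1-η)^n (1+η)^n ≤ 1` and Bernoulli's inequality, `(1-ε)(1 + nη) ≤ 1`, so `nη ≤ ε / (1-ε)`.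
-/
theorem nat_mul_le_two_mul_of_one_sub_pow_le {η ε : ℝ} (hη : 0 < η) (hη1 : η < 1)
    (hε1 : ε ≤ 1 / 3) {n : ℕ} (h : 1 - (1 - η) ^ n ≤ ε) : n * η ≤ 2 * ε := by
  have h1 : 1 + n * η ≤ (1 + η) ^ n := one_add_mul_le_pow (by linarith) n
  have h2 : (1 - η) ^ n * (1 + η) ^ n ≤ 1 := by
    rw [← mul_pow]
    exact pow_le_one₀ (mul_nonneg (by linarith) (by linarith)) (by nlinarith)
  have h3 : 0 ≤ n * η := by positivity
  have h4 : (1 - ε) * (1 + n * η) ≤ 1 :=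
    (mul_le_mul (by linarith) h1 (by linarith) (pow_nonneg (by linarith) n)).trans h2
  nlinarith

/-- As `1/3 < e^(-1)`, the hypothesis forces `2nθ^2 ≥ 1`. This lower bound on `θ` lets a bound on
`nη` become one on `η` relative to `θ`. -/
theorem one_le_two_mul_nat_mul_of_exp_le {θ : ℝ} (hθ : 0 < θ) {n : ℕ} (hn : 0 < n)
    (h : Real.exp (-(2 * n * θ ^ 2)) ≤ 1 / 3) : 1 ≤ 2 * n * θ := by
  have hn' : (1 : ℝ) ≤ n := by exact_mod_cast hn
  have h1 : 1 ≤ 2 * n * θ ^ 2 := by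
    by_contra hcon
    push Not at hcon
    have h2 : Real.exp (-1) < Real.exp (-(2 * n * θ ^ 2)) := Real.exp_lt_exp.2 (by linarith)
    have h3 : (1 : ℝ) / 3 < Real.exp (-1) := by
      rw [Real.exp_neg, ← one_div]
      exact one_div_lt_one_div_of_lt (Real.exp_pos 1) (by linarith [Real.exp_one_lt_d9])
    linarith
  by_contra hcon
  push Not at hcon
  nlinarith

/-- The threshold only decreases when `(1+η)^(1/q)` is replaced by 1 and the nonnegative truncation
term is dropped. -/
theorem le_threshold {d n : ℕ} {p q κ M η T θ t : ℝ} (hp : 0 < p) (hpq : p < q) (hn : 0 < n)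
    (hM : 0 < M) (hT : 0 < T) (hκ : 0 < κ) (hη : 0 < η) (ht : θ * (M * T) ^ p ≤ t) :
    M ^ p * (κ ^ p * (n : ℝ) ^ (-(p / d)) + θ * T ^ p) ≤
      (κ * M * (1 + η) ^ (1 / q) * (n : ℝ) ^ (-(1 / (d : ℝ)))
              + truncConst p q * M * η ^ (1 / p - 1 / q)) ^ p + t := by
  have hn0 : (0 : ℝ) < n := by exact_mod_cast hn
  have hq : 0 < q := by linarith
  have h1 : M ^ p * (κ ^ p * (n : ℝ) ^ (-(p / d))) =
      (κ * M * 1 * (n : ℝ) ^ (-(1 / (d : ℝ)))) ^ p := by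
    rw [mul_one, Real.mul_rpow (by positivity) (by positivity), Real.mul_rpow hκ.le hM.le,
      ← Real.rpow_mul hn0.le, show -(1 / (d : ℝ)) * p = -(p / d) by ring]
    ring
  have h2 : M ^ p * (θ * T ^ p) ≤ t := by
    refine le_trans (le_of_eq ?_) ht
    rw [Real.mul_rpow hM.le hT.le]
    ring
  rw [mul_add, h1]
  refine add_le_add (Real.rpow_le_rpow (by positivity) ?_ hp.le) h2
  have h4 : 0 ≤ truncConst p q * M * η ^ (1 / p - 1 / q) := by
    have := truncConst_nonneg hp hpq
    positivity
  have h5 : (1 : ℝ) ≤ (1 + η) ^ (1 / q) := Real.one_le_rpow (by linarith) (by positivity)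
  have h6 : κ * M * 1 * (n : ℝ) ^ (-(1 / (d : ℝ))) ≤
      κ * M * (1 + η) ^ (1 / q) * (n : ℝ) ^ (-(1 / (d : ℝ))) := by gcongr
  linarith

theorem le_of_rpow_neg_le {T q a b Y : ℝ} (hT : 0 < T) (hq : 0 < q) (ha : 0 ≤ a)
    (h : T ^ (-q) ≤ b) (haY : a ^ q ≤ Y) (hY : b * Y ≤ 1 / 2) : a ≤ T := by
  have hTq : 0 < T ^ (-q) := by positivity
  have h1 : a ^ q * T ^ (-q) ≤ 1 := by
    have : a ^ q * T ^ (-q) ≤ Y * b :=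
      mul_le_mul haY h hTq.le ((Real.rpow_nonneg ha q).trans haY)
    linarith
  have h2 : a ^ q ≤ T ^ q := by
    rw [Real.rpow_neg hT.le, ← div_eq_mul_inv, div_le_one (by positivity)] at h1
    exact h1
  exact (Real.rpow_le_rpow_iff ha hT.le hq).1 h2

/-- The concentration inequality, for every constant that is large enough. -/
theorem IsIIDSample.concentration {E : Type*} [NormedAddCommGroup E]
    [NormedSpace ℝ E] [FiniteDimensional ℝ E] [MeasurableSpace E] [BorelSpace E] {d : ℕ}
    {L : E →ₗ[ℝ] (Fin d → ℝ)} {e : E} {M : ℝ} {Ω : Type*} [MeasurableSpace Ω] {P : Measure Ω}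
    [IsProbabilityMeasure P] {μ : Measure E} [IsProbabilityMeasure μ] {n : ℕ} {x : Fin n → Ω → E}
    (hx : IsIIDSample P μ x) (hn : 0 < n) (hd : 1 ≤ d) (hL : ∀ x i, |L x i| ≤ ‖x‖)
    (hL' : ∀ x, ‖x‖ ≤ d * ‖L x‖) (hM : 0 < M) {p q C κ ε η t : ℝ} (hp : 1 ≤ p) (hpq : p < q)
    (hC : 0 < C) (hκ0 : 0 < κ) (hκ : (2 * d) ^ p * (2 * C) = ε * κ ^ p) (hε : 0 < ε)
    (hε1 : ε ≤ 1 / 3)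
    (hε2 : 2 * ε * ((128 * d) ^ q * Real.exp (4 * (8 * (4 * d : ℝ) ^ p) ^ 2)) ≤ 1 / 2)
    (hε3 : 2 * ε * ((2 * d) ^ p * (2 * 2 ^ q * (64 * d) ^ (q - p) * (1 - (2 : ℝ) ^ (p - q))⁻¹))
      ≤ 1 / 8)
    (hη : 0 < η) (hη1 : η < 1) (hmom : momentNorm q e μ ≤ ENNReal.ofReal M) {J : ℕ}
    (hbase : ∫⁻ y, ENNReal.ofReal (cellWeight p (shell e M y) J) ∂μ
      ≤ ENNReal.ofReal (C * (n : ℝ) ^ (-(p / d))))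
    (hcell : ∫⁻ ω, cellSum L e M p J (empiricalMeasure (fun i => x i ω)) μ ∂P
      ≤ ENNReal.ofReal (C * (n : ℝ) ^ (-(p / d)))) :
    P {ω | ENNReal.ofReal
          ((κ * M * (1 + η) ^ (1 / q) * (n : ℝ) ^ (-(1 / (d : ℝ)))
              + truncConst p q * M * η ^ (1 / p - 1 / q)) ^ p + t)
        ≤ wasserstein p (empiricalMeasure fun i => x i ω) μ ^ p}
      ≤ ENNReal.ofReal (1 - (1 - η) ^ n
            + Real.exp (-(2 * n * max (t - (1 - (1 - η) ^ n) * (M * η ^ (-(1 / q))) ^ p) 0 ^ 2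
                  / (M * η ^ (-(1 / q))) ^ (2 * p)))) := by
  have hn' : (1 : ℝ) ≤ n := by exact_mod_cast hn
  have hn0 : (0 : ℝ) < n := by linarith
  have hd' : (1 : ℝ) ≤ d := by exact_mod_cast hd
  have hp0 : 0 < p := by linarith
  have hq : 0 < q := by linarith
  have hr1 : (2 : ℝ) ^ (p - q) < 1 :=
    Real.rpow_lt_one_of_one_lt_of_neg one_lt_two (by linarith)
  have hr1' : 0 < (1 - (2 : ℝ) ^ (p - q))⁻¹ := inv_pos.2 (by linarith)
  set T := η ^ (-(1 / q)) with hT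
  have hT0 : 0 < T := by positivity
  have hTη : T ^ (-q) = η := by
    rw [hT, ← Real.rpow_mul hη.le, show -(1 / q) * -q = 1 by field_simp, Real.rpow_one]
  set π := 1 - (1 - η) ^ n with hπ
  have hπ0 : 0 ≤ π := by
    have : (1 - η) ^ n ≤ 1 := pow_le_one₀ (by linarith) (by linarith)
    linarith
  have hRp : 0 < (M * T) ^ p := by positivity
  have hR2p : (M * T) ^ (2 * p) = ((M * T) ^ p) ^ 2 := by
    rw [mul_comm 2 p, Real.rpow_mul (by positivity), Real.rpow_two]
  -- `θ` is the effective deviation in units of the `p`-th power of the truncation radius `M T`; the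
  -- exponent becomes `2 n θ^2`. When `θ ≤ 0` the exponential is 1 and the bound is trivial.
  set θ := (t - π * (M * T) ^ p) / (M * T) ^ p with hθ
  have hθt : t - π * (M * T) ^ p = θ * (M * T) ^ p := by rw [hθ]; field_simp
  rcases le_or_gt θ 0 with hθ0 | hθ0
  · have hle : t - π * (M * T) ^ p ≤ 0 := by
      rw [hθt]; exact mul_nonpos_of_nonpos_of_nonneg hθ0 hRp.le
    rw [max_eq_right hle]
    refine prob_le_one.trans ?_
    rw [← ENNReal.ofReal_one]
    apply ENNReal.ofReal_le_ofReal
    simp [hπ0]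
  have hmax : max (t - π * (M * T) ^ p) 0 = θ * (M * T) ^ p := by
    rw [hθt]; exact max_eq_left (by positivity)
  have hexpo : 2 * n * max (t - π * (M * T) ^ p) 0 ^ 2 / (M * T) ^ (2 * p) = 2 * n * θ ^ 2 := by
    rw [hmax, hR2p]; field_simp
  rw [hexpo]
  set A := C * (n : ℝ) ^ (-(p / d)) with hA
  have hA0 : 0 < A := by positivity
  set k := κ ^ p * (n : ℝ) ^ (-(p / d)) with hk
  have hk0 : 0 < k := by positivity
  have hAk : (2 * d) ^ p * (2 * A) = ε * k := by
    rw [hA, hk, ← mul_assoc ε, ← hκ]; ring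
  have hlevel : M ^ p * (k + θ * T ^ p) ≤
      (κ * M * (1 + η) ^ (1 / q) * (n : ℝ) ^ (-(1 / (d : ℝ)))
              + truncConst p q * M * η ^ (1 / p - 1 / q)) ^ p + t := by
    rw [hk]
    refine le_threshold hp0 hpq hn hM hT0 hκ0 hη ?_
    rw [← hθt]
    have : 0 ≤ π * (M * T) ^ p := by positivity
    linarith
  -- Either both terms of the bound are small and the truncation argument applies, or the bound
  -- exceeds `ε` and Markov suffices.
  by_cases hcase : π ≤ ε ∧ Real.exp (-(2 * n * θ ^ 2)) ≤ 1 / 3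
  · obtain ⟨hc1, hc2⟩ := hcase
    have hnη := nat_mul_le_two_mul_of_one_sub_pow_le hη hη1 hε1 hc1
    have hηε : η ≤ 2 * ε := (le_mul_of_one_le_left hη.le hn').trans hnη
    set Y := (128 * d) ^ q * Real.exp (4 * (8 * (4 * d : ℝ) ^ p) ^ 2) with hY
    set Z := (2 * d) ^ p * (2 * 2 ^ q * (64 * d) ^ (q - p) * (1 - (2 : ℝ) ^ (p - q))⁻¹) with hZ
    have hY0 : 0 < Y := by positivity
    have hZ0 : 0 < Z := by positivity
    have hTd : 64 * d ≤ T := by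
      refine le_of_rpow_neg_le hT0 hq (by positivity) (by rw [hTη]; exact hηε) ?_ hε2
      have h2 : (64 * d : ℝ) ^ q ≤ (128 * d) ^ q :=
        Real.rpow_le_rpow (by positivity) (by linarith) hq.le
      have h3 : 1 ≤ Real.exp (4 * (8 * (4 * d : ℝ) ^ p) ^ 2) := Real.one_le_exp (by positivity)
      exact h2.trans (le_mul_of_one_le_right (by positivity) h3)
    refine (measure_mono fun ω hω => ?_).trans
      (hx.measure_wasserstein_ge_le hn hd hL hL' hM hp hpq hT0 hη1.le hTη hA0.le hθ0
        (κ := k) (by rw [hAk]; exact mul_le_of_le_one_left hk0.le (by linarith)) hmom hbase hcell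
        hTd ?_ ?_ hc2)
    · exact (ENNReal.ofReal_le_ofReal hlevel).trans hω
    · have h1 := one_le_two_mul_nat_mul_of_exp_le hθ0 hn hc2
      have h2 : n * (Z * η) ≤ 1 / 8 := by
        calc n * (Z * η) = (n * η) * Z := by ring
          _ ≤ 2 * ε * Z := by gcongr
          _ ≤ 1 / 8 := hε3
      have h3 : n * (Z * η) ≤ n * (θ / 4) := by linarith
      exact le_of_mul_le_mul_left h3 hn0
    · calc n * η * Y ≤ 2 * ε * Y := by gcongr
        _ ≤ 1 / 2 := hε2
  -- By the choice of `κ`, Markov at level `M^p k` gives exactly `ε`.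
  · have hε' : ε ≤ π + Real.exp (-(2 * n * θ ^ 2)) := by
      have := Real.exp_pos (-(2 * n * θ ^ 2))
      by_contra hcon
      push Not at hcon
      exact hcase ⟨by linarith, by linarith⟩
    have h1 := hx.measure_wasserstein_ge_le_div hn hd hL' hM hp0 hA0.le hk0 hbase hcell
    rw [hAk, mul_div_cancel_right₀ _ hk0.ne'] at h1
    refine (measure_mono fun ω hω => ?_).trans (h1.trans (ENNReal.ofReal_le_ofReal hε'))
    refine le_trans (ENNReal.ofReal_le_ofReal ?_) hω
    refine le_trans ?_ hlevel
    have : 0 ≤ θ * T ^ p := by positivity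
    gcongr
    linarith

end Main

end EmpiricalWasserstein

theorem mainTheorem7 (d : ℕ) (p q : ℝ) (hp : 1 ≤ p) (hpd : p < (d : ℝ) / 2)
    (hq : (d : ℝ) * p / ((d : ℝ) - p) < q) :
    ∃ κ : ℝ, 0 < κ ∧
      -- `κ` is a constant for the expectation bound
      (∀ (E : Type*) [NormedAddCommGroup E] [NormedSpace ℝ E] [FiniteDimensional ℝ E]
          [MeasurableSpace E] [BorelSpace E], Module.finrank ℝ E = d →
        ∀ (Ω : Type*) [MeasurableSpace Ω] (P : Measure Ω) [IsProbabilityMeasure P]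
          (μ : Measure E) [IsProbabilityMeasure μ] (n : ℕ) (x : Fin n → Ω → E),
          0 < n → EmpiricalWasserstein.IsIIDSample P μ x →
          (∫⁻ ω, EmpiricalWasserstein.wasserstein p
              (EmpiricalWasserstein.empiricalMeasure fun i => x i ω) μ ^ p ∂P) ^ (1 / p)
            ≤ ENNReal.ofReal κ * EmpiricalWasserstein.momentNorm q 0 μ
              * ENNReal.ofReal ((n : ℝ) ^ (-(1 / (d : ℝ))))) ∧
      -- and with the same `κ` the concentration inequality holds
      (∀ (E : Type*) [NormedAddCommGroup E] [NormedSpace ℝ E] [FiniteDimensional ℝ E]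
          [MeasurableSpace E] [BorelSpace E], Module.finrank ℝ E = d →
        ∀ (Ω : Type*) [MeasurableSpace Ω] (P : Measure Ω) [IsProbabilityMeasure P]
          (μ : Measure E) [IsProbabilityMeasure μ] (n : ℕ) (x : Fin n → Ω → E) (e : E)
          (M η t : ℝ),
          0 < n → EmpiricalWasserstein.IsIIDSample P μ x →
          0 < M → EmpiricalWasserstein.momentNorm q e μ ≤ ENNReal.ofReal M →
          0 < η → η < 1 → 0 < t →
          P {ω | ENNReal.ofReal
                ((κ * M * (1 + η) ^ (1 / q) * (n : ℝ) ^ (-(1 / (d : ℝ)))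
                    + EmpiricalWasserstein.truncConst p q * M * η ^ (1 / p - 1 / q)) ^ p + t)
              ≤ EmpiricalWasserstein.wasserstein p
                  (EmpiricalWasserstein.empiricalMeasure fun i => x i ω) μ ^ p}
            ≤ ENNReal.ofReal
                (1 - (1 - η) ^ n
                  + Real.exp
                      (-(2 * n * max (t - (1 - (1 - η) ^ n) * (M * η ^ (-(1 / q))) ^ p) 0 ^ 2
                        / (M * η ^ (-(1 / q))) ^ (2 * p))))) := by
  have hd0 : (0 : ℝ) < d := by linarith
  have hd : 1 ≤ d := by
    have : 0 < d := by exact_mod_cast hd0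
    exact this
  obtain ⟨hpq, s, hs, hs1, hps, hqs⟩ :=
    EmpiricalWasserstein.exists_interpolation_exponent hp hpd hq
  have hr1 : (2 : ℝ) ^ (p - q) < 1 :=
    Real.rpow_lt_one_of_one_lt_of_neg one_lt_two (by linarith)
  have hr1' : 0 < (1 - (2 : ℝ) ^ (p - q))⁻¹ := inv_pos.2 (by linarith)
  have hC := EmpiricalWasserstein.multiscaleConst_pos hpq hps hqs
  set C := EmpiricalWasserstein.multiscaleConst d p q s
  set Y := (128 * d) ^ q * Real.exp (4 * (8 * (4 * d : ℝ) ^ p) ^ 2) with hY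
  set Z := (2 * d) ^ p * (2 * 2 ^ q * (64 * d) ^ (q - p) * (1 - (2 : ℝ) ^ (p - q))⁻¹) with hZ
  have hY0 : 0 < Y := by positivity
  have hZ0 : 0 < Z := by positivity
  -- `Y` governs the expected number of outer points in the Chernoff bound, and `Z` the tail of `μ`
  -- beyond the inner shells; both depend on `p, q, d` only.
  obtain ⟨ε, hε, hε1, hεY, hεZ⟩ : ∃ ε : ℝ, 0 < ε ∧ ε ≤ 1 / 3 ∧ 2 * ε * Y ≤ 1 / 2 ∧
      2 * ε * Z ≤ 1 / 8 := by
    refine ⟨min (1 / 3) (min (1 / (4 * Y)) (1 / (16 * Z))), by positivity, min_le_left _ _, ?_, ?_⟩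
    · calc _ ≤ 2 * (1 / (4 * Y)) * Y := by
            gcongr; exact (min_le_right _ _).trans (min_le_left _ _)
        _ = 1 / 2 := by field_simp; norm_num
    · calc _ ≤ 2 * (1 / (16 * Z)) * Z := by
            gcongr; exact (min_le_right _ _).trans (min_le_right _ _)
        _ = 1 / 8 := by field_simp; norm_num
  have hB : 0 < (2 * d) ^ p * (2 * C) / ε := by positivity
  have hκp : (((2 * d) ^ p * (2 * C) / ε) ^ (1 / p)) ^ p = (2 * d) ^ p * (2 * C) / ε := by
    rw [← Real.rpow_mul hB.le, one_div_mul_cancel (by linarith), Real.rpow_one]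
  -- The expectation bound alone needs only `κ^p ≥ (2d)^p · 2C`; the extra factor `1/ε` is the price
  -- for using the same constant in the concentration inequality.
  set κ := ((2 * d) ^ p * (2 * C) / ε) ^ (1 / p) with hκ
  have hκ0 : 0 < κ := by positivity
  have hκε : (2 * d) ^ p * (2 * C) = ε * κ ^ p := by rw [hκp]; field_simp
  refine ⟨κ, hκ0, ?_, ?_⟩
  · intro E _ _ _ _ _ hE Ω _ P _ μ _ n x hn hx
    obtain ⟨L, hL, hL'⟩ := EmpiricalWasserstein.exists_auerbach_coordinates hE
    obtain ⟨J, hJ⟩ := hx.exists_multiscale_le hp hd0 hpq hs hs1 hps hqs hn hL 0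
    refine EmpiricalWasserstein.rpow_lintegral_wasserstein_le hp hd hκ0 ?_ hn hL' hC hJ
    rw [hκε]
    have : 0 < κ ^ p := by positivity
    nlinarith
  · intro E _ _ _ _ _ hE Ω _ P _ μ _ n x e M η t hn hx hM hmom hη hη1 ht
    obtain ⟨L, hL, hL'⟩ := EmpiricalWasserstein.exists_auerbach_coordinates hE
    obtain ⟨J, hJ⟩ := hx.exists_multiscale_le hp hd0 hpq hs hs1 hps hqs hn hL e
    obtain ⟨h1, h2⟩ := hJ M hM hmom
    exact hx.concentration hn hd hL hL' hM hp hpq hC hκ0 hκε hε hε1 hεY hεZ hη hη1 hmom h1 h2
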